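/- Consider a queue with Poisson arrivals of rate $\lambda>0$, an infinite waiting room, and $K$ groups of parallel exponential servers; group $k$ has $M_k$ servers, each of which, when turned on, works at rate $\mu_k>0$ and costs $c_k\ge 0$ per unit time. The state is the number $n\in\mathbb N$ of customers in the system (customers may move freely between servers, switching servers on or off costs nothing). An efficient stationary policy $d$ chooses in every state $n$ a vector $d(n)=(d(n,1),\dots,d(n,K))$ of numbers of working servers, with $0\le d(n,k)\le M_k$ and $\sum_k d(n,k)\le n$. Under $d$ the state process $(n_t)_{t\ge 0}$ is the continuous-time Markov chain that jumps from $n$ to $n+1$ at rate $\lambda$ and from $n$ to $n-1$ at rate $\sum_k d(n,k)\mu_k$; its generator is denoted by $B^d$. The cost rate is $f(n,m)=h(n)+\sum_k m_kc_k$, where the holding cost $h:\mathbb N\to\mathbb R$ is increasing (i.e. nondecreasing) and convex (i.e. $h(n+2)-2h(n+1)+h(n)\ge 0$ for all $n$) and $h(n)\to\infty$ as $n\to\infty$. The long-run average cost of $d$ is $\eta^d=\lim_{T\to\infty}\mathbb E\{\frac1T\int_0^T f(n_t,d(n_t))\,dt\}$. Let $d^*$ be an efficient policy whose long-run average cost $\eta^*$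 is finite and minimal among all efficient policies. Let $g^*:\mathbb N\to\mathbb R$ be the performance potential of $d^*$, $$g^*(n)=\lim_{T\to\infty}\mathbb E\Big\{\int_0^T[f(n_t,d^*(n_t))-\eta^*]\,dt\ \Big|\ n_0=n\Big\},\qquad n\in\mathbb N$$ (whenever these limits exist), or, more generally, any relative value function of $d^*$, i.e. any solution of the Poisson equation $f(n,d^*(n))-\eta^*+(B^{d^*}g^*)(n)=0$ for all $n\in\mathbb N$. Then $g^*$ is increasing (nondecreasing) and convex in $n$: $g^*(n+1)\ge g^*(n)$ and $g^*(n+2)-2g^*(n+1)+g^*(n)\ge 0$ for all $n\in\mathbb N$. -/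

import Mathlib

open MeasureTheory Filter Topology

noncomputable section

/-- The data of a group-server queue: Poisson arrival rate `lam`, `K` groups of parallel exponential
servers, group `k` having `M k` servers with service rate `mu k` and operating cost rate `c k` per
working server, and a holding cost rate `h n` when `n` customers are in the system. -/
structure GroupServerQueue where
  K : ℕ
  lam : ℝ
  M : Fin K → ℕ
  mu : Fin K → ℝ
  c : Fin K → ℝ
  h : ℕ → ℝ

/-- Convexity of a real function of a nonnegative integer: nonnegative second differences. -/
def ConvexSeq (u : ℕ → ℝ) : Prop :=
  ∀ n, 0 ≤ u (n + 2) - 2 * u (n + 1) + u n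

namespace GroupServerQueue

variable (Q : GroupServerQueue)

/-- A scheduling action: the number of working servers in each group. -/
abbrev Action : Type := Fin Q.K → ℕ

/-- A stationary policy: a map from states (numbers of customers) to actions. -/
abbrev Policy : Type := ℕ → Q.Action

/-- The efficient actions in state `n`: at most `M k` servers of group `k` are working, and at most
`n` servers in total. -/
def efficientActions (n : ℕ) : Set Q.Action :=
  {m | (∀ k, m k ≤ Q.M k) ∧ ∑ k, m k ≤ n}

/-- The efficient policy space. -/
def efficientPolicies : Set Q.Policy :=
  {d | ∀ n, d n ∈ Q.efficientActions n}

/-- Total service rate of an action. -/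
def serviceRate (m : Q.Action) : ℝ := ∑ k, (m k : ℝ) * Q.mu k

/-- Total cost rate: holding cost plus linear operating cost. -/
def costRate (n : ℕ) (m : Q.Action) : ℝ := Q.h n + ∑ k, (m k : ℝ) * Q.c k

/-- The infinitesimal generator under policy `d`, acting on functions of the state: jumps
`n → n + 1` at rate `lam`, and `n → n - 1` at the total service rate of `d n` (which is `0` in
state `0` for an efficient policy). -/
def generator (d : Q.Policy) (u : ℕ → ℝ) (n : ℕ) : ℝ :=
  Q.lam * (u (n + 1) - u n) + Q.serviceRate (d n) * (u (n - 1) - u n)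

/-- The uniformization constant, a bound for the total jump rate in every state. -/
def unifRate : ℝ := Q.lam + ∑ k, (Q.M k : ℝ) * Q.mu k

/-- The one-step operator `I + B / Λ` of the uniformized chain, where `B` is the generator and
`Λ` the uniformization constant. -/
def unifStep (d : Q.Policy) (u : ℕ → ℝ) (n : ℕ) : ℝ :=
  u n + Q.generator d u n / Q.unifRate

/-- The transition function `(exp (t B)) (i, j)` of the continuous-time Markov chain with the
(bounded) generator `B` of policy `d`, written as
`exp (-Λ t) * ∑ l, (Λ t) ^ l / l! * ((I + B / Λ) ^ l) (i, j)`. -/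
def transProb (d : Q.Policy) (t : ℝ) (i j : ℕ) : ℝ :=
  ∑' l : ℕ, Real.exp (-(Q.unifRate * t)) * (Q.unifRate * t) ^ l / (l.factorial : ℝ) *
    ((Q.unifStep d)^[l] (Pi.single j 1)) i

/-- Under the probability measure `P`, the process `X t`, `t ≥ 0`, is a continuous-time Markov chain
on `ℕ` whose generator is that of policy `d`, started in `n₀`: it is a (jointly) measurable process,
as every process with right-continuous paths is, it starts in `n₀` almost surely, and
`P (X t = j | X u, u ≤ s) = transProb (t - s) (X s) j` for all `0 ≤ s ≤ t`. -/
structure IsMarkovChain {Ω : Type*} [MeasurableSpace Ω] (d : Q.Policy) (n₀ : ℕ)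
    (P : Measure Ω) (X : ℝ → Ω → ℕ) : Prop where
  isProbabilityMeasure : IsProbabilityMeasure P
  measurable : Measurable fun p : ℝ × Ω => X p.1 p.2
  initial : ∀ᵐ ω ∂P, X 0 ω = n₀
  markov : ∀ s t : ℝ, 0 ≤ s → s ≤ t → ∀ (j : ℕ) (A : Set Ω),
    MeasurableSet[⨆ u ∈ Set.Icc 0 s, MeasurableSpace.comap (X u) ⊤] A →
      P.real (A ∩ {ω | X t ω = j}) = ∫ ω in A, Q.transProb d (t - s) (X s ω) j ∂P

variable {Ω : Type*} [MeasurableSpace Ω]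

/-- `η` is the (finite) long-run average cost of policy `d`: from every initial state `n`, the
expected total cost up to any finite time is finite and
`η = lim_{T → ∞} E_n [(1 / T) ∫_0^T f (n_t, d (n_t)) dt]`.
Here `P d n` is the law governing the process `X` under policy `d` and initial state `n`. -/
def HasAverageCost (P : Q.Policy → ℕ → Measure Ω) (X : ℝ → Ω → ℕ) (d : Q.Policy) (η : ℝ) : Prop :=
  ∀ n : ℕ,
    (∀ T : ℝ, Integrable (fun p : ℝ × Ω => Q.costRate (X p.1 p.2) (d (X p.1 p.2)))
      ((volume.restrict (Set.Ioc 0 T)).prod (P d n))) ∧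
    Tendsto (fun T : ℝ =>
      ∫ ω, (1 / T) * (∫ t in (0 : ℝ)..T, Q.costRate (X t ω) (d (X t ω))) ∂(P d n)) atTop (𝓝 η)

/-- `d` is an optimal policy, with finite optimal long-run average cost `η`: it is an efficient
policy, and no efficient policy has a smaller long-run average cost (policies with infinite
long-run average cost do not compete). -/
structure IsOptimal (P : Q.Policy → ℕ → Measure Ω) (X : ℝ → Ω → ℕ) (d : Q.Policy) (η : ℝ) :
    Prop where
  efficient : d ∈ Q.efficientPolicies
  hasAverageCost : Q.HasAverageCost P X d η
  le : ∀ d' ∈ Q.efficientPolicies, ∀ η' : ℝ, Q.HasAverageCost P X d' η' → η ≤ η'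

/-- `g` is the performance potential of policy `d` with long-run average cost `η`:
`g n = E_n ∫_0^∞ [f (n_t, d (n_t)) - η] dt`, as the limit of the expectations up to time `T`. -/
def IsPotential (P : Q.Policy → ℕ → Measure Ω) (X : ℝ → Ω → ℕ) (d : Q.Policy) (η : ℝ)
    (g : ℕ → ℝ) : Prop :=
  ∀ n : ℕ, Tendsto (fun T : ℝ =>
    ∫ ω, (∫ t in (0 : ℝ)..T, (Q.costRate (X t ω) (d (X t ω)) - η)) ∂(P d n)) atTop (𝓝 (g n))

/-- `g` is a relative value function of policy `d` with long-run average cost `η`: it solves the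
Poisson equation `f - η 1 + B g = 0`. -/
def IsRelativeValue (d : Q.Policy) (η : ℝ) (g : ℕ → ℝ) : Prop :=
  ∀ n : ℕ, Q.costRate n (d n) - η + Q.generator d g n = 0

end GroupServerQueue

end

/-!
Uniformization turns the queue under a policy `d` into a birth–death chain whose upward probability
does not depend on the state. Such a chain is stochastically monotone, so the expectations of
monotone functions converge in time, and the long-run average cost becomes the limit of the expected
cost rate in discrete time.

Write `G n = g n - g (n - 1)` for the differences of a relative value function `g` of the optimal
policy. Every policy that improves on the optimal one in a single state, in the sense of the Poisson
equation, would have a smaller average cost, provided that the state is recurrent and `g` is bounded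
below. Hence the optimal policy uses, in every state `n`, an action of maximal gain
`F n (G n) = max (∑ m k * (mu k * G n - c k))`, and it never idles in a nonempty system. The Poisson
equation becomes the recursion `lam * G (n + 1) = η - h n + F n (G n)`. Since `F n` is increasing
and its increments in `n` are decreasing, and since `h` is convex, a first descent of `G` would be
repeated at least as steeply in every later state, so that `G` would tend to `-∞`; but `g` is
eventually nondecreasing, because the stationary cost above a high level exceeds `η`. So `G` is
nondecreasing, and `G 0 = 0`.
-/

noncomputable section

namespace ConvexSeq

variable {u : ℕ → ℝ}

theorem monotone_increments (hu : ConvexSeq u) : Monotone fun n => u (n + 1) - u n :=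
  monotone_nat_of_le_succ fun n => by linarith [hu n]

theorem tangent_le (hu : ConvexSeq u) (N n : ℕ) :
    u N + (u (N + 1) - u N) * ((n : ℝ) - N) ≤ u n := by
  rcases le_total N n with h | h
  · induction n, h using Nat.le_induction with
    | base => simp
    | succ n h ih =>
      have := hu.monotone_increments h
      push_cast
      linarith
  · induction h using Nat.decreasingInduction with
    | self => simp
    | of_succ n h ih =>
      have := hu.monotone_increments h.le
      push_cast at ih
      linarith

theorem exists_mul_le_add (hu : ConvexSeq u) (hlim : Tendsto u atTop atTop) :
    ∃ s > 0, ∃ C, ∀ n : ℕ, s * n ≤ u n + C := by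
  obtain ⟨N, hN⟩ : ∃ N, u N < u (N + 1) := by
    by_contra! hanti
    obtain ⟨n, hn⟩ := (hlim.eventually_gt_atTop (u 0)).exists
    exact hn.not_ge (antitone_nat_of_succ_le hanti (Nat.zero_le n))
  refine ⟨_, sub_pos.2 hN, (u (N + 1) - u N) * N - u N, fun n => ?_⟩
  linarith [hu.tangent_le N n]

end ConvexSeq

/-- The backward difference `g n - g (n - 1)`, the loss of value at a service completion in state
`n`; it vanishes at `0`, where truncated subtraction gives `0 - 1 = 0`. -/
def backwardDiff (g : ℕ → ℝ) (n : ℕ) : ℝ := g n - g (n - 1)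

@[simp]
theorem backwardDiff_zero (g : ℕ → ℝ) : backwardDiff g 0 = 0 := sub_self _

@[simp]
theorem backwardDiff_succ (g : ℕ → ℝ) (n : ℕ) : backwardDiff g (n + 1) = g (n + 1) - g n := rfl

theorem monotone_of_monotone_backwardDiff {g : ℕ → ℝ} (hg : Monotone (backwardDiff g)) :
    Monotone g :=
  monotone_nat_of_le_succ fun n => sub_nonneg.1 (by simpa using hg (Nat.zero_le (n + 1)))

theorem convexSeq_of_monotone_backwardDiff {g : ℕ → ℝ} (hg : Monotone (backwardDiff g)) :
    ConvexSeq g := fun n => by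
  have := hg (Nat.le_succ (n + 1))
  simp only [Nat.succ_eq_add_one, backwardDiff_succ] at this
  linarith

/-- The function `g` with its values below `m` replaced by the affine extrapolation with the slope
of `g` between `m` and `m + 1`. -/
def extendBelow (g : ℕ → ℝ) (m n : ℕ) : ℝ :=
  if m ≤ n then g n else g m - backwardDiff g (m + 1) * ((m : ℝ) - n)

theorem extendBelow_of_le {g : ℕ → ℝ} {m n : ℕ} (h : m ≤ n) : extendBelow g m n = g n := if_pos h

theorem backwardDiff_extendBelow_succ_of_le {g : ℕ → ℝ} {m n : ℕ} (h : n ≤ m) :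
    backwardDiff (extendBelow g m) (n + 1) = backwardDiff g (m + 1) := by
  rw [backwardDiff_succ]
  rcases h.eq_or_lt with rfl | hlt
  · rw [extendBelow_of_le n.le_succ, extendBelow_of_le le_rfl, backwardDiff_succ]
  · rw [extendBelow, extendBelow, if_neg hlt.not_ge]
    split_ifs with hm
    · obtain rfl : m = n + 1 := hm.antisymm hlt
      push_cast
      ring
    · push_cast
      ring

theorem backwardDiff_extendBelow_of_lt {g : ℕ → ℝ} {m n : ℕ} (h : m < n) :
    backwardDiff (extendBelow g m) n = backwardDiff g n := by
  rw [backwardDiff, backwardDiff, extendBelow_of_le h.le,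
    extendBelow_of_le (Nat.le_sub_one_of_lt h)]

theorem bddBelow_range_of_eventually_le_succ {g : ℕ → ℝ} (hg : ∀ᶠ n in atTop, g n ≤ g (n + 1)) :
    BddBelow (Set.range g) := by
  obtain ⟨N, hN⟩ := eventually_atTop.1 hg
  refine IsBoundedUnder.bddBelow_range ⟨g N, eventually_map.2 (eventually_atTop.2 ⟨N, ?_⟩)⟩
  exact fun n hn => Nat.le_induction le_rfl (fun k hk ih => ih.trans (hN k hk)) n hn

theorem bddBelow_range_extendBelow {g : ℕ → ℝ} (hg : ∀ᶠ n in atTop, g n ≤ g (n + 1)) (m : ℕ) :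
    BddBelow (Set.range (extendBelow g m)) := by
  refine bddBelow_range_of_eventually_le_succ ?_
  filter_upwards [hg, eventually_ge_atTop m] with n hn hmn
  rwa [extendBelow_of_le hmn, extendBelow_of_le (hmn.trans n.le_succ)]

theorem tendsto_atBot_of_increment_le {g : ℕ → ℝ} {δ : ℝ} (hδ : δ < 0)
    (hg : ∀ᶠ n in atTop, g (n + 1) - g n ≤ δ) : Tendsto g atTop atBot := by
  obtain ⟨N, hN⟩ := eventually_atTop.1 hg
  have hle : ∀ n ≥ N, g n ≤ g N - δ * N + δ * n := fun n hn => by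
    induction n, hn using Nat.le_induction with
    | base => simp
    | succ n hn ih =>
      push_cast
      linarith [hN n hn]
  exact tendsto_atBot_mono' _ (eventually_atTop.2 ⟨N, hle⟩)
    (tendsto_atBot_add_const_left _ _ (tendsto_natCast_atTop_atTop.const_mul_atTop_of_neg hδ))

-- From the first descent of `G` on, every step of `G` is at least as steep, so that `G` tends to
-- `-∞`.
theorem monotone_of_recursion {lam η : ℝ} (hlam : 0 < lam) {h : ℕ → ℝ} (hh : ConvexSeq h)
    {F : ℕ → ℝ → ℝ} (hF : ∀ n, Monotone (F n))
    (hmarginal : ∀ {n n' x y}, n ≤ n' → x ≤ y → F (n' + 1) x - F n' x ≤ F (n + 1) y - F n y)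
    {G : ℕ → ℝ} (hG : ∀ n, lam * G (n + 1) = η - h n + F n (G n)) (hzero : G 0 ≤ G 1)
    (hnonneg : ∀ᶠ n in atTop, 0 ≤ G n) : Monotone G := by
  by_contra hmono
  obtain ⟨n, hmin, hlt⟩ : ∃ n, G n ≤ G (n + 1) ∧ G (n + 2) < G (n + 1) := by
    by_contra! hstep
    exact hmono (monotone_nat_of_le_succ fun n => Nat.rec hzero hstep n)
  have hsteep : ∀ i ≥ n + 1, G (i + 1) ≤ G (n + 1) ∧ G (i + 1) - G i ≤ G (n + 2) - G (n + 1) := by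
    intro i hi
    induction i, hi using Nat.le_induction with
    | base => exact ⟨hlt.le, le_rfl⟩
    | succ i hi ih =>
      have hincr : G (i + 2) - G (i + 1) ≤ G (n + 2) - G (n + 1) := by
        refine le_of_mul_le_mul_left ?_ hlam
        have hni : n ≤ i := (Nat.le_succ n).trans hi
        linarith [hG (i + 1), hG i, hG (n + 1), hG n, hh.monotone_increments hni,
          hmarginal hni ih.1, hF i (show G (i + 1) ≤ G i by linarith), hF n hmin]
      exact ⟨by linarith, hincr⟩
  have hbot := tendsto_atBot_of_increment_le (sub_neg.2 hlt)
    (eventually_atTop.2 ⟨n + 1, fun i hi => (hsteep i hi).2⟩)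
  obtain ⟨i, hi_neg, hi⟩ := ((hbot.eventually_lt_atBot 0).and hnonneg).exists
  exact hi.not_gt hi_neg

theorem nonpos_of_monotone_of_sum_range_le {A : ℕ → ℝ} (hA : Monotone A) {K : ℝ}
    (hK : ∀ n, ∑ i ∈ Finset.range n, A i ≤ K) (l : ℕ) : A l ≤ 0 := by
  by_contra! hpos
  obtain ⟨n, hn⟩ := exists_nat_gt ((K - ∑ i ∈ Finset.range l, A i) / A l)
  have hsum : n * A l ≤ ∑ i ∈ Finset.range n, A (l + i) := by
    simpa using Finset.card_nsmul_le_sum (Finset.range n) (fun i => A (l + i)) (A l)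
      fun i _ => hA (Nat.le_add_right l i)
  have := hK (l + n)
  rw [Finset.sum_range_add] at this
  rw [div_lt_iff₀ hpos] at hn
  linarith

theorem single_one_le {ι : Type*} [DecidableEq ι] {m : ι → ℕ} {k : ι} (hk : 0 < m k) :
    Pi.single k 1 ≤ m := fun j => by
  rcases eq_or_ne j k with rfl | hj
  · rwa [Pi.single_eq_same]
  · rw [Pi.single_eq_of_ne hj]
    exact Nat.zero_le _

/-- A birth–death chain on `ℕ` in discrete time: up with probability `up`, and down from `n` with
probability `down n`. -/
structure BirthDeathChain where
  up : ℝ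
  down : ℕ → ℝ

namespace BirthDeathChain

/-- The jump probabilities are admissible, upward jumps have positive probability, and `0` is never
left downwards. The bound `up + down n ≤ 1`, with `up` constant, makes the chain stochastically
monotone. -/
structure IsStochastic (C : BirthDeathChain) : Prop where
  up_pos : 0 < C.up
  down_nonneg : ∀ n, 0 ≤ C.down n
  up_add_down_le_one : ∀ n, C.up + C.down n ≤ 1
  down_zero : C.down 0 = 0

variable (C : BirthDeathChain)

/-- The one-step transition operator, acting on functions of the state. -/
def step : Module.End ℝ (ℕ → ℝ) where
  toFun u n := u n + C.up * (u (n + 1) - u n) + C.down n * (u (n - 1) - u n)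
  map_add' u v := by ext n; simp only [Pi.add_apply]; ring
  map_smul' c u := by ext n; simp only [Pi.smul_apply, smul_eq_mul, RingHom.id_apply]; ring

/-- The expectation of `u` at time `l` for the chain started in `i`. -/
def mean (u : ℕ → ℝ) (i l : ℕ) : ℝ := (C.step ^ l) u i

variable {C} {u v : ℕ → ℝ}

theorem step_apply (u : ℕ → ℝ) (n : ℕ) :
    C.step u n = u n + C.up * (u (n + 1) - u n) + C.down n * (u (n - 1) - u n) := rfl

@[simp]
theorem mean_zero (u : ℕ → ℝ) (i : ℕ) : C.mean u i 0 = u i := rfl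

theorem mean_succ (u : ℕ → ℝ) (i l : ℕ) :
    C.mean u i (l + 1) = C.mean u i l + C.up * (C.mean u (i + 1) l - C.mean u i l)
      + C.down i * (C.mean u (i - 1) l - C.mean u i l) := by
  rw [mean, pow_succ']
  rfl

theorem mean_step (u : ℕ → ℝ) (i l : ℕ) : C.mean (C.step u) i l = C.mean u i (l + 1) := by
  rw [mean, mean, pow_succ]
  rfl

theorem mean_add (u v : ℕ → ℝ) (i : ℕ) : C.mean (u + v) i = C.mean u i + C.mean v i := by
  ext l
  simp only [mean, map_add, Pi.add_apply]

theorem mean_sub (u v : ℕ → ℝ) (i : ℕ) : C.mean (u - v) i = C.mean u i - C.mean v i := by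
  ext l
  simp only [mean, map_sub, Pi.sub_apply]

theorem mean_smul (c : ℝ) (u : ℕ → ℝ) (i : ℕ) : C.mean (c • u) i = c • C.mean u i := by
  ext l
  simp only [mean, map_smul, Pi.smul_apply]

theorem mean_const (c : ℝ) (i l : ℕ) : C.mean (fun _ => c) i l = c := by
  induction l generalizing i with
  | zero => rfl
  | succ l ih => simp only [mean_succ, ih, sub_self, mul_zero, add_zero]

theorem hasSum_mean_single_mul (u : ℕ → ℝ) (i l : ℕ) :
    HasSum (fun j => C.mean (Pi.single j 1) i l * u j) (C.mean u i l) := by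
  induction l generalizing i with
  | zero =>
    simpa using hasSum_single (f := fun j => (Pi.single j (1 : ℝ) : ℕ → ℝ) i * u j) i
      fun j hj => by simp [hj.symm]
  | succ l ih =>
    simp only [mean_succ]
    convert ((ih i).add (((ih (i + 1)).sub (ih i)).mul_left C.up)).add
      (((ih (i - 1)).sub (ih i)).mul_left (C.down i)) using 2
    ring

theorem tendsto_mean_of_tendsto {ι : Type*} {f : Filter ι} {v : ι → ℕ → ℝ}
    (hv : ∀ i, Tendsto (fun N => v N i) f (𝓝 (u i))) (i l : ℕ) :
    Tendsto (fun N => C.mean (v N) i l) f (𝓝 (C.mean u i l)) := by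
  induction l generalizing i with
  | zero => exact hv i
  | succ l ih =>
    simp only [mean_succ]
    exact ((ih i).add (((ih (i + 1)).sub (ih i)).const_mul C.up)).add
      (((ih (i - 1)).sub (ih i)).const_mul (C.down i))

namespace IsStochastic

theorem mean_nonneg (hC : C.IsStochastic) (hu : 0 ≤ u) (i l : ℕ) : 0 ≤ C.mean u i l := by
  induction l generalizing i with
  | zero => exact hu i
  | succ l ih =>
    have hup := mul_nonneg hC.up_pos.le (ih (i + 1))
    have hdown := mul_nonneg (hC.down_nonneg i) (ih (i - 1))
    have hstay := mul_nonneg (sub_nonneg.2 (hC.up_add_down_le_one i)) (ih i)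
    rw [mean_succ]
    linarith

theorem mean_mono (hC : C.IsStochastic) (huv : u ≤ v) (i l : ℕ) : C.mean u i l ≤ C.mean v i l := by
  have := hC.mean_nonneg (sub_nonneg.2 huv) i l
  rwa [mean_sub, Pi.sub_apply, sub_nonneg] at this

theorem abs_mean_le (hC : C.IsStochastic) (u : ℕ → ℝ) (i l : ℕ) :
    |C.mean u i l| ≤ C.mean |u| i l := by
  have hneg := hC.mean_mono (neg_le_abs u) i l
  rw [← neg_one_smul ℝ u, mean_smul, Pi.smul_apply, neg_one_smul] at hneg
  exact abs_le'.2 ⟨hC.mean_mono (le_abs_self u) i l, hneg⟩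

theorem le_mean (hC : C.IsStochastic) {c : ℝ} (hu : ∀ n, c ≤ u n) (i l : ℕ) : c ≤ C.mean u i l :=
  (mean_const c i l).symm.trans_le (hC.mean_mono hu i l)

theorem mean_le (hC : C.IsStochastic) {c : ℝ} (hu : ∀ n, u n ≤ c) (i l : ℕ) : C.mean u i l ≤ c :=
  (hC.mean_mono hu i l).trans_eq (mean_const c i l)

theorem monotone_mean_state (hC : C.IsStochastic) (hu : Monotone u) (l : ℕ) :
    Monotone fun i => C.mean u i l := by
  induction l with
  | zero => exact hu
  | succ l ih =>
    refine monotone_nat_of_le_succ fun n => ?_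
    have hup := mul_nonneg hC.up_pos.le (sub_nonneg.2 (ih (Nat.le_succ (n + 1))))
    have hdown := mul_nonneg (hC.down_nonneg n) (sub_nonneg.2 (ih (Nat.sub_le n 1)))
    have hstay := mul_nonneg (sub_nonneg.2 (hC.up_add_down_le_one (n + 1)))
      (sub_nonneg.2 (ih (Nat.le_succ n)))
    simp only [mean_succ, Nat.add_sub_cancel, Nat.succ_eq_add_one] at *
    linarith

theorem monotone_mean (hC : C.IsStochastic) (hu : Monotone u) {i : ℕ} (hi : C.down i = 0) :
    Monotone (C.mean u i) := by
  refine monotone_nat_of_le_succ fun l => ?_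
  rw [mean_succ, hi, zero_mul, add_zero, le_add_iff_nonneg_right]
  exact mul_nonneg hC.up_pos.le (sub_nonneg.2 (hC.monotone_mean_state hu l (Nat.le_succ i)))

theorem ofReal_mean_eq_tsum (hC : C.IsStochastic) (hu : 0 ≤ u) (i l : ℕ) :
    ENNReal.ofReal (C.mean u i l) =
      ∑' j, ENNReal.ofReal (C.mean (Pi.single j 1) i l) * ENNReal.ofReal (u j) := by
  have hsum := hasSum_mean_single_mul (C := C) u i l
  have hsingle : ∀ j, 0 ≤ C.mean (Pi.single j 1) i l := fun j =>
    hC.mean_nonneg (Pi.single_nonneg.2 zero_le_one) i l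
  rw [← hsum.tsum_eq,
    ENNReal.ofReal_tsum_of_nonneg (fun j => mul_nonneg (hsingle j) (hu j)) hsum.summable]
  exact tsum_congr fun j => ENNReal.ofReal_mul (hsingle j)

end IsStochastic

variable (C) in
/-- The expectations of `|u|` from the state `0`, hence from every state, are bounded in time. -/
def HasBoundedMeans (u : ℕ → ℝ) : Prop := ∃ c, ∀ l, C.mean |u| 0 l ≤ c

namespace HasBoundedMeans

theorem mono (hC : C.IsStochastic) (hu : C.HasBoundedMeans u) (hvu : |v| ≤ |u|) :
    C.HasBoundedMeans v :=
  hu.imp fun _ hc l => (hC.mean_mono hvu 0 l).trans (hc l)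

theorem add (hC : C.IsStochastic) (hu : C.HasBoundedMeans u) (hv : C.HasBoundedMeans v) :
    C.HasBoundedMeans (u + v) := by
  obtain ⟨c, hc⟩ := hu
  obtain ⟨c', hc'⟩ := hv
  refine ⟨c + c', fun l => (hC.mean_mono (abs_add_le u v) 0 l).trans ?_⟩
  rw [mean_add]
  exact add_le_add (hc l) (hc' l)

theorem const_smul (hu : C.HasBoundedMeans u) (a : ℝ) : C.HasBoundedMeans (a • u) := by
  obtain ⟨c, hc⟩ := hu
  refine ⟨|a| * c, fun l => ?_⟩
  have : |a • u| = |a| • |u| := funext fun n => abs_mul a (u n)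
  rw [this, mean_smul]
  exact mul_le_mul_of_nonneg_left (hc l) (abs_nonneg a)

theorem of_abs_le (hC : C.IsStochastic) {c : ℝ} (hu : ∀ n, |u n| ≤ c) : C.HasBoundedMeans u :=
  ⟨c, hC.mean_le hu 0⟩

theorem of_bddBelow (hC : C.IsStochastic) (hu : BddBelow (Set.range u)) {c : ℝ}
    (hc : ∀ l, C.mean u 0 l ≤ c) : C.HasBoundedMeans u := by
  obtain ⟨b, hb⟩ := hu
  have habs : |u| ≤ u + fun _ => 2 * |b| := fun n => by
    have := hb ⟨n, rfl⟩
    exact abs_le.2 ⟨by simp only [Pi.add_apply]; linarith [neg_abs_le b],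
      by simp only [Pi.add_apply]; linarith [abs_nonneg b]⟩
  refine ⟨c + 2 * |b|, fun l => (hC.mean_mono habs 0 l).trans ?_⟩
  rw [mean_add, Pi.add_apply, mean_const]
  linarith [hc l]

theorem natCast (hC : C.IsStochastic) (hu : C.HasBoundedMeans u) (hconv : ConvexSeq u)
    (hlim : Tendsto u atTop atTop) : C.HasBoundedMeans fun n => n := by
  obtain ⟨s, hs, b, hb⟩ := hconv.exists_mul_le_add hlim
  refine ((hu.add hC (.of_abs_le hC (u := fun _ => b) fun _ => le_rfl)).const_smul s⁻¹).mono hC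
    fun n => ?_
  have hle : (n : ℝ) ≤ s⁻¹ * (u n + b) := (le_inv_mul_iff₀' hs).2 (by linarith [hb n])
  exact abs_le_abs_of_nonneg (Nat.cast_nonneg n) hle

theorem exists_mean_le (hC : C.IsStochastic) (hu : C.HasBoundedMeans u) (i : ℕ) :
    ∃ c, ∀ l, C.mean |u| i l ≤ c := by
  induction i with
  | zero => exact hu
  | succ k ih =>
    obtain ⟨c, hc⟩ := ih
    refine ⟨c / C.up, fun l => ?_⟩
    have hdown := mul_nonneg (hC.down_nonneg k) (hC.mean_nonneg (abs_nonneg u) (k - 1) l)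
    have hstay := mul_nonneg (sub_nonneg.2 (hC.up_add_down_le_one k))
      (hC.mean_nonneg (abs_nonneg u) k l)
    have hle := hc (l + 1)
    rw [mean_succ] at hle
    rw [le_div_iff₀' hC.up_pos]
    linarith

theorem exists_abs_mean_le (hC : C.IsStochastic) (hu : C.HasBoundedMeans u) (i : ℕ) :
    ∃ c, ∀ l, |C.mean u i l| ≤ c :=
  (hu.exists_mean_le hC i).imp fun _ hc l => (hC.abs_mean_le u i l).trans (hc l)

end HasBoundedMeans

theorem up_mul_sum_mean_sub (u : ℕ → ℝ) (k n : ℕ) :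
    C.up * ∑ l ∈ Finset.range n, (C.mean u (k + 1) l - C.mean u k l) =
      C.mean u k n - u k +
        C.down k * ∑ l ∈ Finset.range n, (C.mean u k l - C.mean u (k - 1) l) := by
  have htel : C.mean u k n - u k = ∑ l ∈ Finset.range n, (C.mean u k (l + 1) - C.mean u k l) :=
    (Finset.sum_range_sub (C.mean u k) n).symm
  rw [htel, Finset.mul_sum, Finset.mul_sum, ← Finset.sum_add_distrib]
  refine Finset.sum_congr rfl fun l _ => ?_
  rw [mean_succ]
  ring

namespace IsStochastic

theorem exists_sum_mean_sub_le (hC : C.IsStochastic) (hu : C.HasBoundedMeans u) (k : ℕ) :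
    ∃ c, ∀ n, ∑ l ∈ Finset.range n, (C.mean u (k + 1) l - C.mean u k l) ≤ c := by
  induction k with
  | zero =>
    obtain ⟨c, hc⟩ := hu.exists_abs_mean_le hC 0
    refine ⟨(c - u 0) / C.up, fun n => ?_⟩
    rw [le_div_iff₀' hC.up_pos, up_mul_sum_mean_sub, hC.down_zero]
    linarith [le_abs_self _ |>.trans (hc n)]
  | succ k ih =>
    obtain ⟨c₁, h₁⟩ := ih
    obtain ⟨c₂, h₂⟩ := hu.exists_abs_mean_le hC (k + 1)
    refine ⟨(c₂ - u (k + 1) + C.down (k + 1) * c₁) / C.up, fun n => ?_⟩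
    rw [le_div_iff₀' hC.up_pos, up_mul_sum_mean_sub, Nat.add_sub_cancel]
    linarith [le_abs_self _ |>.trans (h₂ n),
      mul_le_mul_of_nonneg_left (h₁ n) (hC.down_nonneg (k + 1))]

theorem exists_tendsto_mean_of_monotone (hC : C.IsStochastic) (hmono : Monotone u)
    (hu : C.HasBoundedMeans u) : ∃ c, ∀ i, Tendsto (C.mean u i) atTop (𝓝 c) := by
  refine ⟨⨆ l, C.mean u 0 l, fun i => ?_⟩
  induction i with
  | zero =>
    obtain ⟨c, hc⟩ := hu.exists_abs_mean_le hC 0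
    refine tendsto_atTop_ciSup (hC.monotone_mean hmono hC.down_zero) ⟨c, ?_⟩
    rintro _ ⟨l, rfl⟩
    exact (le_abs_self _).trans (hc l)
  | succ k ih =>
    obtain ⟨c, hc⟩ := hC.exists_sum_mean_sub_le hu k
    have hdiff := (summable_of_sum_range_le (fun l => sub_nonneg.2
      (hC.monotone_mean_state hmono l (Nat.le_succ k))) hc).tendsto_atTop_zero
    simpa using hdiff.add ih

theorem exists_tendsto_mean_of_sub_le (hC : C.IsStochastic)
    (hid : C.HasBoundedMeans fun n => n) (hu : C.HasBoundedMeans u) {B : ℝ}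
    (hB : ∀ n, u n - B ≤ u (n + 1)) : ∃ c, ∀ i, Tendsto (C.mean u i) atTop (𝓝 c) := by
  have hmono : Monotone (u + B • fun n : ℕ => (n : ℝ)) := monotone_nat_of_le_succ fun n => by
    simp only [Pi.add_apply, Pi.smul_apply, smul_eq_mul]
    push_cast
    linarith [hB n]
  obtain ⟨c, hc⟩ := hC.exists_tendsto_mean_of_monotone hmono (hu.add hC (hid.const_smul B))
  obtain ⟨c', hc'⟩ := hC.exists_tendsto_mean_of_monotone Nat.mono_cast hid
  refine ⟨c - B * c', fun i => ((hc i).sub ((hc' i).const_mul B)).congr fun l => ?_⟩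
  simp only [mean_add, mean_smul, Pi.add_apply, Pi.smul_apply, smul_eq_mul, add_sub_cancel_right]

/-! ### Drift inequalities -/

theorem mean_add_sum_le (hC : C.IsStochastic) {g e : ℕ → ℝ} (h : C.step g ≤ g - e) (i n : ℕ) :
    C.mean g i n + ∑ l ∈ Finset.range n, C.mean e i l ≤ g i := by
  induction n with
  | zero => simp
  | succ n ih =>
    have := hC.mean_mono h i n
    rw [mean_step, mean_sub, Pi.sub_apply] at this
    rw [Finset.sum_range_succ]
    linarith

theorem hasBoundedMeans_of_drift (hC : C.IsStochastic) (hu : Monotone u) {g : ℕ → ℝ}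
    (hg : BddBelow (Set.range g)) {c : ℝ} (h : C.step g ≤ g - (u - fun _ => c)) :
    C.HasBoundedMeans u := by
  obtain ⟨b, hb⟩ := hg
  have hmono : Monotone (u - fun _ => c) := fun m n hmn => sub_le_sub_right (hu hmn) c
  have hsum : ∀ n, ∑ l ∈ Finset.range n, C.mean (u - fun _ => c) 0 l ≤ g 0 - b := fun n => by
    linarith [hC.mean_add_sum_le h 0 n, hC.le_mean (fun k => hb ⟨k, rfl⟩) 0 n]
  refine .of_bddBelow hC ⟨u 0, ?_⟩ (c := c) fun l => ?_
  · rintro _ ⟨n, rfl⟩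
    exact hu (Nat.zero_le n)
  · have := nonpos_of_monotone_of_sum_range_le (hC.monotone_mean hmono hC.down_zero) hsum l
    rwa [mean_sub, Pi.sub_apply, mean_const, sub_nonpos] at this

theorem nonpos_of_drift (hC : C.IsStochastic) {g e : ℕ → ℝ} {i : ℕ} {c : ℝ}
    (hg : BddBelow (Set.range g)) (h : C.step g ≤ g - e)
    (he : Tendsto (C.mean e i) atTop (𝓝 c)) : c ≤ 0 := by
  obtain ⟨b, hb⟩ := hg
  have hzero : Tendsto (fun n : ℕ => (n : ℝ)⁻¹ * (g i - b)) atTop (𝓝 0) := by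
    simpa using (tendsto_inv_atTop_nhds_zero_nat (𝕜 := ℝ)).mul_const (g i - b)
  refine le_of_tendsto_of_tendsto' he.cesaro hzero fun n => ?_
  refine mul_le_mul_of_nonneg_left ?_ (by positivity)
  linarith [hC.mean_add_sum_le h i n, hC.le_mean (fun k => hb ⟨k, rfl⟩) i n]

end IsStochastic

/-! ### The limiting distribution -/

variable (C) in
/-- `p` is the limiting distribution of the chain, from every initial state. -/
def IsLimitLaw (p : ℕ → ℝ) : Prop :=
  ∀ k i, Tendsto (C.mean (Pi.single k 1) i) atTop (𝓝 (p k))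

theorem single_eq_indicator_sub (k : ℕ) :
    (Pi.single k 1 : ℕ → ℝ) = (Set.Ici k).indicator 1 - (Set.Ici (k + 1)).indicator 1 := by
  ext n
  rcases lt_trichotomy n k with h | h | h
  · simp [h.ne, Set.indicator, h.not_ge, show ¬ k + 1 ≤ n by omega]
  · simp [h, Set.indicator]
  · simp [h.ne', Set.indicator, h.le, show k + 1 ≤ n by omega]

theorem monotone_indicator_Ici (k : ℕ) : Monotone ((Set.Ici k).indicator (1 : ℕ → ℝ)) := by
  intro m n hmn
  by_cases h : k ≤ m
  · simp [Set.indicator, h, h.trans hmn]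
  · simp only [Set.indicator, Set.mem_Ici, h, if_false]
    split_ifs <;> simp

theorem step_indicator_Ici_succ (k : ℕ) :
    C.step ((Set.Ici (k + 1)).indicator 1) = (Set.Ici (k + 1)).indicator 1
      + (C.up • Pi.single k 1 - C.down (k + 1) • Pi.single (k + 1) 1) := by
  ext n
  simp only [step_apply, Set.indicator, Set.mem_Ici, Pi.add_apply, Pi.sub_apply, Pi.smul_apply,
    Pi.single_apply, smul_eq_mul, Pi.one_apply]
  rcases lt_trichotomy n k with h | rfl | h
  · simp [show ¬ k + 1 ≤ n by omega, show ¬ k ≤ n by omega, show ¬ k + 1 ≤ n - 1 by omega,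
      show n ≠ k by omega, show n ≠ k + 1 by omega]
  · simp [show ¬ n + 1 ≤ n - 1 by omega]
  · rcases eq_or_ne n (k + 1) with rfl | hne
    · simp
    · simp [show k + 1 ≤ n by omega, show k + 1 ≤ n - 1 by omega, show k ≤ n by omega, hne, h.ne']

namespace IsStochastic

theorem exists_tendsto_mean_indicator_Ici (hC : C.IsStochastic) (k : ℕ) :
    ∃ c, ∀ i, Tendsto (C.mean ((Set.Ici k).indicator 1) i) atTop (𝓝 c) := by
  refine hC.exists_tendsto_mean_of_monotone (monotone_indicator_Ici k)
    (.of_abs_le hC (c := 1) fun n => ?_)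
  simp only [Set.indicator]
  split_ifs <;> simp

theorem exists_isLimitLaw (hC : C.IsStochastic) : ∃ p, C.IsLimitLaw p := by
  choose c hc using hC.exists_tendsto_mean_indicator_Ici
  refine ⟨fun k => c k - c (k + 1), fun k i => ?_⟩
  rw [single_eq_indicator_sub, mean_sub]
  exact (hc k i).sub (hc (k + 1) i)

end IsStochastic

namespace IsLimitLaw

variable {p : ℕ → ℝ}

theorem nonneg (hC : C.IsStochastic) (hp : C.IsLimitLaw p) (k : ℕ) : 0 ≤ p k :=
  ge_of_tendsto' (hp k 0) fun l => hC.mean_nonneg (Pi.single_nonneg.2 zero_le_one) 0 l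

theorem balance (hC : C.IsStochastic) (hp : C.IsLimitLaw p) (k : ℕ) :
    C.up * p k = C.down (k + 1) * p (k + 1) := by
  obtain ⟨c, hc⟩ := hC.exists_tendsto_mean_indicator_Ici (k + 1)
  have hstep : Tendsto (C.mean (C.step ((Set.Ici (k + 1)).indicator 1)) 0) atTop (𝓝 c) :=
    ((tendsto_add_atTop_iff_nat 1).2 (hc 0)).congr fun l => (mean_step _ 0 l).symm
  rw [step_indicator_Ici_succ, mean_add, mean_sub, mean_smul, mean_smul] at hstep
  have := tendsto_nhds_unique hstep
    ((hc 0).add (((hp k 0).const_smul C.up).sub ((hp (k + 1) 0).const_smul (C.down (k + 1)))))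
  simp only [smul_eq_mul] at this
  linarith

theorem tendsto_mean_indicator_Iio (hp : C.IsLimitLaw p) (x : ℕ → ℝ) (i M : ℕ) :
    Tendsto (C.mean ((Set.Iio M).indicator x) i) atTop (𝓝 (∑ k ∈ Finset.range M, x k * p k)) := by
  induction M with
  | zero => simp [funext (mean_const (C := C) 0 i)]
  | succ M ih =>
    have : (Set.Iio (M + 1)).indicator x = (Set.Iio M).indicator x + x M • Pi.single M 1 := by
      ext n
      rcases lt_trichotomy n M with h | rfl | h
      · simp [h, h.ne, h.trans (Nat.lt_succ_self M)]
      · simp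
      · simp [h.ne', h.not_gt, show ¬ n < M + 1 by omega]
    rw [this, mean_add, mean_smul, Finset.sum_range_succ]
    exact ih.add ((hp M i).const_smul (x M))

theorem exists_pos (hC : C.IsStochastic) (hp : C.IsLimitLaw p) (hu : C.HasBoundedMeans u)
    (hlim : Tendsto u atTop atTop) : ∃ k, 0 < p k := by
  by_contra! hnonpos
  obtain ⟨c, hc⟩ := hu
  obtain ⟨N, hN⟩ := eventually_atTop.1 (hlim.eventually_ge_atTop (c + 1))
  have hle : (fun _ : ℕ => c + 1) ≤ (Set.Iio N).indicator (fun _ => c + 1) + |u| := fun n => by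
    by_cases hn : n < N
    · simp [hn]
    · simpa [hn] using (hN n (not_lt.1 hn)).trans (le_abs_self (u n))
  have hmass : c + 1 ≤ ∑ k ∈ Finset.range N, (c + 1) * p k + c := by
    refine ge_of_tendsto' ((hp.tendsto_mean_indicator_Iio _ 0 N).add_const c) fun l => ?_
    have := hC.mean_mono hle 0 l
    rw [mean_const, mean_add, Pi.add_apply] at this
    linarith [hc l]
  simp only [fun k => (hnonpos k).antisymm (hp.nonneg hC k), mul_zero,
    Finset.sum_const_zero] at hmass
  linarith

theorem pos (hC : C.IsStochastic) (hp : C.IsLimitLaw p) (hu : C.HasBoundedMeans u)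
    (hlim : Tendsto u atTop atTop) {m : ℕ} (hm : ∀ j, m < j → 0 < C.down j) {k : ℕ}
    (hk : m ≤ k) : 0 < p k := by
  obtain ⟨j, hj⟩ := hp.exists_pos hC hu hlim
  have hup : 0 < p (max j k) := by
    refine Nat.le_induction hj (fun n _ hn => ?_) (max j k) (le_max_left j k)
    exact pos_of_mul_pos_right (hp.balance hC n ▸ mul_pos hC.up_pos hn) (hC.down_nonneg (n + 1))
  refine Nat.decreasingInduction' (fun n _ hkn hn => ?_) (le_max_right j k) hup
  have := mul_pos (hm (n + 1) (by omega)) hn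
  rw [← hp.balance hC n] at this
  exact pos_of_mul_pos_right this hC.up_pos.le

theorem up_mul_increment_eq (hC : C.IsStochastic) (hp : C.IsLimitLaw p) {g e : ℕ → ℝ}
    (h : C.step g = g - e) (M : ℕ) :
    C.up * p M * (g (M + 1) - g M) = -∑ k ∈ Finset.range (M + 1), e k * p k := by
  have he : ∀ k, e k = C.down k * (g k - g (k - 1)) - C.up * (g (k + 1) - g k) := fun k => by
    have := congrFun h k
    rw [step_apply, Pi.sub_apply] at this
    linarith
  induction M with
  | zero => simp [he 0]; ring
  | succ M ih =>
    rw [Finset.sum_range_succ, neg_add, ← ih, he (M + 1), Nat.add_sub_cancel, hp.balance hC M]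
    ring

theorem eventually_le_succ (hC : C.IsStochastic) (hp : C.IsLimitLaw p)
    (hpos : ∀ᶠ k in atTop, 0 < p k) {g e : ℕ → ℝ} (h : C.step g = g - e) {i : ℕ}
    (he : Tendsto (C.mean e i) atTop (𝓝 0)) (hnonneg : ∀ᶠ k in atTop, 0 ≤ e k) :
    ∀ᶠ k in atTop, g k ≤ g (k + 1) := by
  filter_upwards [hpos, eventually_forall_ge_atTop.2 hnonneg] with M hpM heM
  have hle : (Set.Iio (M + 1)).indicator e ≤ e :=
    Set.indicator_le_self' fun n hn => heM n (by simp at hn; omega)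
  have hsum := le_of_tendsto_of_tendsto' (hp.tendsto_mean_indicator_Iio e i (M + 1)) he
    (hC.mean_mono hle i)
  have hincr := hp.up_mul_increment_eq hC h M
  exact sub_nonneg.1 (nonneg_of_mul_nonneg_right (by linarith) (mul_pos hC.up_pos hpM))

end IsLimitLaw

end BirthDeathChain

/-! ### Poisson means -/

theorem tendsto_tsum_mul_zero_of_tendsto_zero {ι : Type*} {f : Filter ι} {w : ι → ℕ → ℝ}
    (hnonneg : ∀ᶠ x in f, ∀ l, 0 ≤ w x l) (hsum : ∀ᶠ x in f, HasSum (w x) 1)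
    (hw : ∀ l, Tendsto (fun x => w x l) f (𝓝 0)) {s : ℕ → ℝ} (hs : Tendsto s atTop (𝓝 0)) :
    Tendsto (fun x => ∑' l, w x l * s l) f (𝓝 0) := by
  obtain ⟨K, hK⟩ := hs.norm.isBoundedUnder_le.bddAbove_range
  rw [Metric.tendsto_nhds]
  intro ε hε
  obtain ⟨N, hN⟩ := Metric.tendsto_atTop.1 hs (ε / 2) (half_pos hε)
  have hhead : Tendsto (fun x => ∑ l ∈ Finset.range N, w x l * K) f (𝓝 0) := by
    simpa using tendsto_finsetSum (Finset.range N) fun l _ => (hw l).mul_const K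
  filter_upwards [hnonneg, hsum, hhead.eventually (gt_mem_nhds (half_pos hε))] with x h0 h1 hx
  have hdom : HasSum (fun l => w x l * (ε / 2) + if l ∈ Finset.range N then w x l * K else 0)
      (1 * (ε / 2) + ∑ l ∈ Finset.range N, w x l * K) := by
    refine (h1.mul_right (ε / 2)).add ?_
    rw [← Finset.sum_congr rfl fun l hl => if_pos hl]
    exact hasSum_sum_of_ne_finset_zero fun l hl => if_neg hl
  rw [dist_zero_right]
  refine (tsum_of_norm_bounded hdom fun l => ?_).trans_lt (by linarith)
  rw [norm_mul, Real.norm_of_nonneg (h0 l)]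
  split_ifs with hl
  · exact (mul_le_mul_of_nonneg_left (hK ⟨l, rfl⟩) (h0 l)).trans
      (le_add_of_nonneg_left (mul_nonneg (h0 l) (half_pos hε).le))
  · rw [add_zero, ← dist_zero_right]
    exact mul_le_mul_of_nonneg_left (hN l (by simpa using hl)).le (h0 l)

theorem hasDerivAt_tsum_mul_pow_div_factorial {s : ℕ → ℝ} {c : ℝ} (hs : ∀ l, |s l| ≤ c) (x : ℝ) :
    HasDerivAt (fun y => ∑' l : ℕ, s l * (y ^ l / (l.factorial : ℝ)))
      (∑' l : ℕ, s (l + 1) * (x ^ l / (l.factorial : ℝ))) x := by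
  have hc : 0 ≤ c := (abs_nonneg _).trans (hs 0)
  have hshift : ∀ (n : ℕ) (y : ℝ), ((n + 1 : ℕ) : ℝ) * y ^ (n + 1 - 1) / ((n + 1).factorial : ℝ) =
      y ^ n / (n.factorial : ℝ) := fun n y => by
    rw [Nat.factorial_succ, Nat.cast_mul, Nat.add_sub_cancel]
    exact mul_div_mul_left _ _ (by positivity)
  have hsummable : ∀ {s : ℕ → ℝ}, (∀ l, |s l| ≤ c) →
      Summable fun l => s l * (x ^ l / (l.factorial : ℝ)) := fun hs =>
    ((Real.summable_pow_div_factorial x).norm.mul_left c).of_norm_bounded fun l => by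
      rw [norm_mul]
      exact mul_le_mul_of_nonneg_right (hs l) (norm_nonneg _)
  have hderiv : HasDerivAt (fun y => ∑' l : ℕ, s l * (y ^ l / (l.factorial : ℝ)))
      (∑' l : ℕ, s l * (l * x ^ (l - 1) / (l.factorial : ℝ))) x := by
    refine hasDerivAt_tsum_of_isPreconnected (t := Metric.ball 0 (|x| + 1)) (y₀ := x)
      (u := fun n : ℕ => c * (n * (|x| + 1) ^ (n - 1) / (n.factorial : ℝ)))
      (g' := fun l y => s l * (l * y ^ (l - 1) / (l.factorial : ℝ)))
      ?_ Metric.isOpen_ball (convex_ball 0 _).isPreconnected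
      (fun n y _ => ((hasDerivAt_pow n y).div_const _).const_mul (s n)) ?_ (by simp)
      (hsummable hs) (by simp)
    · refine Summable.mul_left c ((summable_nat_add_iff 1).1 ?_)
      simpa only [hshift] using Real.summable_pow_div_factorial (|x| + 1)
    · intro n y hy
      rw [mem_ball_zero_iff, Real.norm_eq_abs] at hy
      rw [norm_mul, norm_div, norm_mul, norm_pow, Real.norm_eq_abs, Real.norm_eq_abs y,
        Real.norm_natCast, Real.norm_natCast]
      gcongr
      exact hs n
  refine hderiv.congr_deriv ?_
  rw [Summable.tsum_eq_zero_add]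
  · simp only [hshift]
    simp
  · rw [← summable_nat_add_iff 1]
    simpa only [hshift] using hsummable fun l => hs (l + 1)

/-- The weight of `l` under the Poisson distribution with mean `x`, which is also defined for
negative `x`. -/
def poissonWeight (x : ℝ) (l : ℕ) : ℝ := Real.exp (-x) * x ^ l / (l.factorial : ℝ)

theorem poissonWeight_nonneg {x : ℝ} (hx : 0 ≤ x) (l : ℕ) : 0 ≤ poissonWeight x l := by
  unfold poissonWeight
  positivity

theorem hasSum_poissonWeight (x : ℝ) : HasSum (poissonWeight x) 1 := by
  have h := (NormedSpace.expSeries_div_hasSum_exp (𝔸 := ℝ) x).mul_left (Real.exp (-x))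
  rw [← Real.exp_eq_exp_ℝ, ← Real.exp_add, neg_add_cancel, Real.exp_zero] at h
  exact h.congr_fun fun l => (mul_div_assoc _ _ _)

theorem tendsto_poissonWeight_atTop (l : ℕ) :
    Tendsto (fun x => poissonWeight x l) atTop (𝓝 0) := by
  have h := (Real.tendsto_pow_mul_exp_neg_atTop_nhds_zero l).div_const (l.factorial : ℝ)
  rw [zero_div] at h
  exact h.congr fun x => by rw [poissonWeight, mul_comm]

/-- The mean of the sequence `s` under the Poisson distribution with mean `x`. -/
def poissonMean (s : ℕ → ℝ) (x : ℝ) : ℝ := ∑' l, poissonWeight x l * s l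

namespace poissonMean

variable {s : ℕ → ℝ} {c : ℝ}

theorem zero_right (s : ℕ → ℝ) : poissonMean s 0 = s 0 := by
  rw [poissonMean, tsum_eq_single 0 fun l hl => by simp [poissonWeight, hl]]
  simp [poissonWeight]

theorem hasSum (hs : ∀ l, |s l| ≤ c) (x : ℝ) :
    HasSum (fun l => poissonWeight x l * s l) (poissonMean s x) := by
  refine (((hasSum_poissonWeight x).summable.norm.mul_right c).of_norm_bounded fun l => ?_).hasSum
  rw [norm_mul]
  exact mul_le_mul_of_nonneg_left (hs l) (norm_nonneg _)

theorem sub {s' : ℕ → ℝ} {c' : ℝ} (hs : ∀ l, |s l| ≤ c) (hs' : ∀ l, |s' l| ≤ c') (x : ℝ) :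
    poissonMean (s - s') x = poissonMean s x - poissonMean s' x := by
  rw [← ((hasSum hs x).sub (hasSum hs' x)).tsum_eq, poissonMean]
  simp only [Pi.sub_apply, mul_sub]

theorem const (k x : ℝ) : poissonMean (fun _ => k) x = k := by
  rw [poissonMean, ((hasSum_poissonWeight x).mul_right k).tsum_eq, one_mul]

theorem nonneg (hs : 0 ≤ s) {x : ℝ} (hx : 0 ≤ x) : 0 ≤ poissonMean s x :=
  tsum_nonneg fun l => mul_nonneg (poissonWeight_nonneg hx l) (hs l)

theorem abs_le (hs : ∀ l, |s l| ≤ c) {x : ℝ} (hx : 0 ≤ x) : |poissonMean s x| ≤ c := by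
  have hdom := (hasSum_poissonWeight x).mul_right c
  rw [one_mul] at hdom
  rw [← Real.norm_eq_abs]
  refine tsum_of_norm_bounded hdom fun l => ?_
  rw [norm_mul, Real.norm_of_nonneg (poissonWeight_nonneg hx l)]
  exact mul_le_mul_of_nonneg_left (hs l) (poissonWeight_nonneg hx l)

theorem ofReal_eq_tsum (hnonneg : 0 ≤ s) (hs : ∀ l, |s l| ≤ c) {x : ℝ} (hx : 0 ≤ x) :
    ENNReal.ofReal (poissonMean s x) =
      ∑' l, ENNReal.ofReal (poissonWeight x l) * ENNReal.ofReal (s l) := by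
  rw [poissonMean, ENNReal.ofReal_tsum_of_nonneg
    (fun l => mul_nonneg (poissonWeight_nonneg hx l) (hnonneg l)) (hasSum hs x).summable]
  exact tsum_congr fun l => ENNReal.ofReal_mul (poissonWeight_nonneg hx l)

theorem tendsto {C : ℝ} (hC : Tendsto s atTop (𝓝 C)) : Tendsto (poissonMean s) atTop (𝓝 C) := by
  obtain ⟨c, hc⟩ := hC.norm.isBoundedUnder_le.bddAbove_range
  have hzero : Tendsto (poissonMean (s - fun _ => C)) atTop (𝓝 0) :=
    tendsto_tsum_mul_zero_of_tendsto_zero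
      ((eventually_ge_atTop 0).mono fun _ hx => poissonWeight_nonneg hx)
      (.of_forall hasSum_poissonWeight) tendsto_poissonWeight_atTop (tendsto_sub_nhds_zero_iff.2 hC)
  refine tendsto_sub_nhds_zero_iff.1 (hzero.congr fun x => ?_)
  rw [sub (fun l => hc ⟨l, rfl⟩) fun _ => le_rfl, const]

theorem hasDerivAt (hs : ∀ l, |s l| ≤ c) (x : ℝ) :
    HasDerivAt (poissonMean s) (poissonMean (fun l => s (l + 1) - s l) x) x := by
  have heq : ∀ s, poissonMean s =
      fun y => Real.exp (-y) * ∑' l : ℕ, s l * (y ^ l / (l.factorial : ℝ)) := fun s => by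
    ext y
    rw [poissonMean, ← tsum_mul_left]
    exact tsum_congr fun l => by rw [poissonWeight]; ring
  have hsub := sub (fun l => hs (l + 1)) hs x
  simp only [Pi.sub_def] at hsub
  rw [hsub, heq s, heq fun l => s (l + 1)]
  refine (((Real.hasDerivAt_exp (-x)).comp x (hasDerivAt_neg x)).mul
    (hasDerivAt_tsum_mul_pow_div_factorial hs x)).congr_deriv ?_
  simp only [Function.comp]
  ring

theorem continuous (hs : ∀ l, |s l| ≤ c) : Continuous (poissonMean s) :=
  continuous_iff_continuousAt.2 fun x => (hasDerivAt hs x).continuousAt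

end poissonMean

theorem tendsto_time_average {φ : ℝ → ℝ} (hφ : Continuous φ) {c C : ℝ}
    (hb : ∀ t, 0 ≤ t → |φ t| ≤ c) (hC : Tendsto φ atTop (𝓝 C)) :
    Tendsto (fun T : ℝ => (1 / T) * ∫ t in (0 : ℝ)..T, φ t) atTop (𝓝 C) := by
  have hscaled : Tendsto (fun T : ℝ => ∫ t in (0 : ℝ)..1, φ (t * T)) atTop
      (𝓝 (∫ _ in (0 : ℝ)..1, C)) := by
    refine intervalIntegral.tendsto_integral_filter_of_dominated_convergence (fun _ => c)
      (.of_forall fun T => (hφ.comp (continuous_mul_const T)).aestronglyMeasurable) ?_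
      intervalIntegrable_const ?_
    · filter_upwards [eventually_ge_atTop (0 : ℝ)] with T hT
      refine .of_forall fun t ht => ?_
      rw [Set.uIoc_of_le zero_le_one] at ht
      exact hb _ (mul_nonneg ht.1.le hT)
    · refine .of_forall fun t ht => ?_
      rw [Set.uIoc_of_le zero_le_one] at ht
      exact hC.comp (tendsto_id.const_mul_atTop ht.1)
  rw [intervalIntegral.integral_const, sub_zero, one_smul] at hscaled
  refine hscaled.congr' ?_
  filter_upwards [eventually_gt_atTop (0 : ℝ)] with T hT
  rw [intervalIntegral.integral_comp_mul_right _ hT.ne', zero_mul, one_mul, smul_eq_mul, one_div]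

/-! ### The uniformized chain of a policy and the law of the queue -/

namespace GroupServerQueue

variable {Q : GroupServerQueue}

theorem unifRate_pos (hlam : 0 < Q.lam) (hmu : ∀ k, 0 ≤ Q.mu k) : 0 < Q.unifRate :=
  add_pos_of_pos_of_nonneg hlam
    (Finset.sum_nonneg fun k _ => mul_nonneg (Nat.cast_nonneg _) (hmu k))

theorem serviceRate_nonneg (hmu : ∀ k, 0 ≤ Q.mu k) (m : Q.Action) : 0 ≤ Q.serviceRate m :=
  Finset.sum_nonneg fun k _ => mul_nonneg (Nat.cast_nonneg _) (hmu k)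

theorem zero_mem_efficientActions (n : ℕ) : (0 : Q.Action) ∈ Q.efficientActions n :=
  ⟨fun _ => Nat.zero_le _, by simp⟩

theorem eq_zero_of_mem_efficientActions_zero {m : Q.Action} (hm : m ∈ Q.efficientActions 0) :
    m = 0 :=
  funext fun k => Finset.sum_eq_zero_iff.1 (Nat.le_zero.1 hm.2) k (Finset.mem_univ k)

@[simp]
theorem serviceRate_zero : Q.serviceRate 0 = 0 := by simp [serviceRate]

variable (Q) in
/-- The discrete-time chain obtained from policy `d` by uniformization; its step operator is
`I + B / Λ`. -/
def chain (d : Q.Policy) : BirthDeathChain where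
  up := Q.lam / Q.unifRate
  down n := Q.serviceRate (d n) / Q.unifRate

theorem unifStep_eq (d : Q.Policy) : Q.unifStep d = (Q.chain d).step := by
  ext u n
  rw [unifStep, generator, BirthDeathChain.step_apply, chain]
  ring

theorem chain_isStochastic (hlam : 0 < Q.lam) (hmu : ∀ k, 0 ≤ Q.mu k) {d : Q.Policy}
    (hd : d ∈ Q.efficientPolicies) : (Q.chain d).IsStochastic where
  up_pos := div_pos hlam (unifRate_pos hlam hmu)
  down_nonneg n := div_nonneg (serviceRate_nonneg hmu _) (unifRate_pos hlam hmu).le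
  up_add_down_le_one n := by
    rw [chain, ← add_div, div_le_one (unifRate_pos hlam hmu), unifRate, serviceRate]
    gcongr with k _
    · exact hmu k
    · exact (hd n).1 k
  down_zero := by simp [chain, eq_zero_of_mem_efficientActions_zero (hd 0)]

variable (Q) in
/-- The transition semigroup `exp (t B)` of policy `d`, applied to `u` and evaluated in `i`. -/
def semigroup (d : Q.Policy) (u : ℕ → ℝ) (i : ℕ) (t : ℝ) : ℝ :=
  poissonMean ((Q.chain d).mean u i) (Q.unifRate * t)

variable {d : Q.Policy} {u : ℕ → ℝ} {i : ℕ}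

theorem transProb_eq_semigroup (d : Q.Policy) (t : ℝ) (i j : ℕ) :
    Q.transProb d t i j = Q.semigroup d (Pi.single j 1) i t := by
  rw [transProb, unifStep_eq]
  simp only [← Module.End.pow_apply]
  rfl

@[simp]
theorem semigroup_zero (d : Q.Policy) (u : ℕ → ℝ) (i : ℕ) : Q.semigroup d u i 0 = u i := by
  rw [semigroup, mul_zero, poissonMean.zero_right, BirthDeathChain.mean_zero]

theorem tendsto_semigroup (hΛ : 0 < Q.unifRate) {c : ℝ}
    (hu : Tendsto ((Q.chain d).mean u i) atTop (𝓝 c)) :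
    Tendsto (Q.semigroup d u i) atTop (𝓝 c) :=
  (poissonMean.tendsto hu).comp (tendsto_id.const_mul_atTop hΛ)

section Semigroup

variable (hC : (Q.chain d).IsStochastic) (hu : (Q.chain d).HasBoundedMeans u)
include hC hu

theorem exists_abs_semigroup_le (hΛ : 0 < Q.unifRate) (i : ℕ) :
    ∃ c, ∀ t, 0 ≤ t → |Q.semigroup d u i t| ≤ c :=
  (hu.exists_abs_mean_le hC i).imp fun _ hc _ ht => poissonMean.abs_le hc (mul_nonneg hΛ.le ht)

theorem continuous_semigroup (i : ℕ) : Continuous (Q.semigroup d u i) := by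
  obtain ⟨c, hc⟩ := hu.exists_abs_mean_le hC i
  exact (poissonMean.continuous hc).comp (continuous_const_mul _)

theorem hasDerivAt_semigroup (hΛ : Q.unifRate ≠ 0) (n : ℕ) (t : ℝ) :
    HasDerivAt (Q.semigroup d u n) (Q.generator d (fun i => Q.semigroup d u i t) n) t := by
  choose c hc using hu.exists_abs_mean_le hC
  have hsum := fun i => poissonMean.hasSum (hc i) (Q.unifRate * t)
  have hterm : ∀ l, poissonWeight (Q.unifRate * t) l *
      ((Q.chain d).mean u n (l + 1) - (Q.chain d).mean u n l) =
      (Q.chain d).up * (poissonWeight (Q.unifRate * t) l * (Q.chain d).mean u (n + 1) l -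
        poissonWeight (Q.unifRate * t) l * (Q.chain d).mean u n l) +
      (Q.chain d).down n * (poissonWeight (Q.unifRate * t) l * (Q.chain d).mean u (n - 1) l -
        poissonWeight (Q.unifRate * t) l * (Q.chain d).mean u n l) := fun l => by
    rw [BirthDeathChain.mean_succ]
    ring
  have hstep := (((hsum (n + 1)).sub (hsum n)).mul_left (Q.chain d).up).add
    (((hsum (n - 1)).sub (hsum n)).mul_left ((Q.chain d).down n))
  refine ((poissonMean.hasDerivAt (hc n) (Q.unifRate * t)).comp t
    ((hasDerivAt_id t).const_mul Q.unifRate)).congr_deriv ?_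
  have hup : (Q.chain d).up = Q.lam / Q.unifRate := rfl
  have hdown : (Q.chain d).down n = Q.serviceRate (d n) / Q.unifRate := rfl
  rw [poissonMean, tsum_congr hterm, hstep.tsum_eq, hup, hdown]
  simp only [generator, semigroup]
  field_simp

theorem generator_integral_semigroup (hΛ : Q.unifRate ≠ 0) (n : ℕ) (T : ℝ) :
    Q.generator d (fun i => ∫ t in (0 : ℝ)..T, Q.semigroup d u i t) n =
      Q.semigroup d u n T - u n := by
  have hcont := continuous_semigroup hC hu
  have hint := fun i => (hcont i).intervalIntegrable (μ := volume) 0 T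
  have hgen : Continuous fun t => Q.generator d (fun i => Q.semigroup d u i t) n := by
    unfold generator
    exact (((hcont _).sub (hcont _)).const_mul _).add (((hcont _).sub (hcont _)).const_mul _)
  have hftc := intervalIntegral.integral_eq_sub_of_hasDerivAt
    (fun t _ => hasDerivAt_semigroup hC hu hΛ n t) (hgen.intervalIntegrable 0 T)
  rw [semigroup_zero] at hftc
  rw [← hftc]
  simp only [generator]
  rw [intervalIntegral.integral_add (((hint _).sub (hint _)).const_mul _)
      (((hint _).sub (hint _)).const_mul _),
    intervalIntegral.integral_const_mul, intervalIntegral.integral_const_mul,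
    intervalIntegral.integral_sub (hint _) (hint _),
    intervalIntegral.integral_sub (hint _) (hint _)]

end Semigroup

variable {Ω : Type*} [MeasurableSpace Ω]

namespace IsMarkovChain

variable {P : Measure Ω} {X : ℝ → Ω → ℕ}

theorem measurable_apply (hX : Q.IsMarkovChain d i P X) (t : ℝ) : Measurable (X t) :=
  hX.measurable.comp measurable_prodMk_left

theorem real_eq_semigroup (hX : Q.IsMarkovChain d i P X) {t : ℝ} (ht : 0 ≤ t) (j : ℕ) :
    P.real {ω | X t ω = j} = Q.semigroup d (Pi.single j 1) i t := by
  have := hX.isProbabilityMeasure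
  have hmarkov := hX.markov 0 t le_rfl ht j Set.univ MeasurableSet.univ
  have hinit : (fun ω => Q.transProb d (t - 0) (X 0 ω) j) =ᵐ[P] fun _ => Q.transProb d t i j := by
    filter_upwards [hX.initial] with ω hω
    rw [hω, sub_zero]
  rw [Set.univ_inter, Measure.restrict_univ, integral_congr_ae hinit, integral_const,
    probReal_univ, one_smul] at hmarkov
  rw [hmarkov, transProb_eq_semigroup]

variable (hX : Q.IsMarkovChain d i P X) (hC : (Q.chain d).IsStochastic) (hΛ : 0 < Q.unifRate)
  (hu : (Q.chain d).HasBoundedMeans u)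
include hX hC hΛ

theorem measure_eq_tsum {t : ℝ} (ht : 0 ≤ t) (j : ℕ) :
    P (X t ⁻¹' {j}) = ∑' l, ENNReal.ofReal (poissonWeight (Q.unifRate * t) l) *
      ENNReal.ofReal ((Q.chain d).mean (Pi.single j 1) i l) := by
  have := hX.isProbabilityMeasure
  have hsingle : 0 ≤ (Pi.single j 1 : ℕ → ℝ) := Pi.single_nonneg.2 zero_le_one
  obtain ⟨c, hc⟩ := (BirthDeathChain.HasBoundedMeans.of_abs_le hC (u := Pi.single j 1)
    (c := 1) fun n => by rw [Pi.single_apply]; split_ifs <;> simp).exists_abs_mean_le hC i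
  rw [← poissonMean.ofReal_eq_tsum (hC.mean_nonneg hsingle i) hc (mul_nonneg hΛ.le ht),
    ← semigroup, ← hX.real_eq_semigroup ht j, ofReal_measureReal]
  rfl

include hu

theorem lintegral_eq (hnonneg : 0 ≤ u) {t : ℝ} (ht : 0 ≤ t) :
    ∫⁻ ω, ENNReal.ofReal (u (X t ω)) ∂P = ENNReal.ofReal (Q.semigroup d u i t) := by
  obtain ⟨c, hc⟩ := hu.exists_abs_mean_le hC i
  calc ∫⁻ ω, ENNReal.ofReal (u (X t ω)) ∂P
      = ∑' j, ENNReal.ofReal (u j) * P (X t ⁻¹' {j}) := by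
        rw [← lintegral_map (measurable_of_countable fun j => ENNReal.ofReal (u j))
          (hX.measurable_apply t), lintegral_countable']
        simp only [Measure.map_apply (hX.measurable_apply t) (measurableSet_singleton _)]
    _ = ∑' (l) (j), ENNReal.ofReal (poissonWeight (Q.unifRate * t) l) *
          (ENNReal.ofReal ((Q.chain d).mean (Pi.single j 1) i l) * ENNReal.ofReal (u j)) := by
        simp only [hX.measure_eq_tsum hC hΛ ht, ← ENNReal.tsum_mul_left]
        rw [ENNReal.tsum_comm]
        simp only [mul_comm (ENNReal.ofReal (u _)), mul_assoc]
    _ = ENNReal.ofReal (Q.semigroup d u i t) := by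
        simp only [ENNReal.tsum_mul_left, ← hC.ofReal_mean_eq_tsum hnonneg]
        exact (poissonMean.ofReal_eq_tsum (hC.mean_nonneg hnonneg i) hc
          (mul_nonneg hΛ.le ht)).symm

theorem integrable_apply {t : ℝ} (ht : 0 ≤ t) : Integrable (fun ω => u (X t ω)) P := by
  refine ⟨((measurable_of_countable u).comp (hX.measurable_apply t)).aestronglyMeasurable, ?_⟩
  rw [hasFiniteIntegral_iff_norm]
  have := hX.lintegral_eq hC hΛ (hu.mono hC (abs_abs u).le) (abs_nonneg u) ht
  exact this.trans_lt ENNReal.ofReal_lt_top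

theorem integral_eq_of_nonneg (hnonneg : 0 ≤ u) {t : ℝ} (ht : 0 ≤ t) :
    ∫ ω, u (X t ω) ∂P = Q.semigroup d u i t := by
  rw [integral_eq_lintegral_of_nonneg_ae (f := fun ω => u (X t ω)) (.of_forall fun ω => hnonneg _)
    (hX.integrable_apply hC hΛ hu ht).aestronglyMeasurable,
    hX.lintegral_eq hC hΛ hu hnonneg ht, ENNReal.toReal_ofReal]
  exact poissonMean.nonneg (hC.mean_nonneg hnonneg i) (mul_nonneg hΛ.le ht)

theorem integral_eq {t : ℝ} (ht : 0 ≤ t) : ∫ ω, u (X t ω) ∂P = Q.semigroup d u i t := by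
  have hpos : (Q.chain d).HasBoundedMeans u⁺ := hu.mono hC fun n => by
    rw [abs_of_nonneg (posPart_nonneg u)]
    exact max_le (le_abs_self (u n)) (abs_nonneg (u n))
  have hneg : (Q.chain d).HasBoundedMeans u⁻ := hu.mono hC fun n => by
    rw [abs_of_nonneg (negPart_nonneg u)]
    exact max_le (neg_le_abs (u n)) (abs_nonneg (u n))
  obtain ⟨c, hc⟩ := hpos.exists_abs_mean_le hC i
  obtain ⟨c', hc'⟩ := hneg.exists_abs_mean_le hC i
  calc ∫ ω, u (X t ω) ∂P = ∫ ω, (u⁺ (X t ω) - u⁻ (X t ω)) ∂P := by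
        simp only [← Pi.sub_apply u⁺ u⁻, posPart_sub_negPart u]
    _ = Q.semigroup d u⁺ i t - Q.semigroup d u⁻ i t := by
        rw [integral_sub (hX.integrable_apply hC hΛ hpos ht) (hX.integrable_apply hC hΛ hneg ht),
          hX.integral_eq_of_nonneg hC hΛ hpos (posPart_nonneg u) ht,
          hX.integral_eq_of_nonneg hC hΛ hneg (negPart_nonneg u) ht]
    _ = Q.semigroup d u i t := by
        rw [semigroup, semigroup, ← poissonMean.sub hc hc', ← BirthDeathChain.mean_sub,
          posPart_sub_negPart, semigroup]

theorem integrable_prod (T : ℝ) :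
    Integrable (fun p : ℝ × Ω => u (X p.1 p.2)) ((volume.restrict (Set.Ioc 0 T)).prod P) := by
  have := hX.isProbabilityMeasure
  have habs := hu.mono hC (abs_abs u).le
  obtain ⟨c, hc⟩ := exists_abs_semigroup_le hC habs hΛ i
  have hmeas : Measurable fun p : ℝ × Ω => u (X p.1 p.2) :=
    (measurable_of_countable u).comp hX.measurable
  refine ⟨hmeas.aestronglyMeasurable, ?_⟩
  rw [hasFiniteIntegral_iff_norm, lintegral_prod _ hmeas.norm.ennreal_ofReal.aemeasurable]
  have hle : ∀ t ∈ Set.Ioc 0 T, ∫⁻ ω, ENNReal.ofReal ‖u (X t ω)‖ ∂P ≤ ENNReal.ofReal c :=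
    fun t ht => (hX.lintegral_eq hC hΛ habs (abs_nonneg u) ht.1.le).trans_le
      (ENNReal.ofReal_le_ofReal ((le_abs_self _).trans (hc t ht.1.le)))
  refine (setLIntegral_mono measurable_const hle).trans_lt ?_
  rw [setLIntegral_const]
  exact ENNReal.mul_lt_top ENNReal.ofReal_lt_top (by simp)

theorem integral_integral_eq {T : ℝ} (hT : 0 ≤ T) :
    ∫ ω, (∫ t in (0 : ℝ)..T, u (X t ω)) ∂P = ∫ t in (0 : ℝ)..T, Q.semigroup d u i t := by
  have := hX.isProbabilityMeasure
  simp only [intervalIntegral.integral_of_le hT]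
  rw [← integral_integral_swap (hX.integrable_prod hC hΛ hu T)]
  exact setIntegral_congr_fun measurableSet_Ioc fun t ht => hX.integral_eq hC hΛ hu ht.1.le

theorem tendsto_average {c : ℝ} (hc : Tendsto ((Q.chain d).mean u i) atTop (𝓝 c)) :
    Tendsto (fun T : ℝ => ∫ ω, (1 / T) * (∫ t in (0 : ℝ)..T, u (X t ω)) ∂P) atTop (𝓝 c) := by
  obtain ⟨b, hb⟩ := exists_abs_semigroup_le hC hu hΛ i
  refine (tendsto_time_average (continuous_semigroup hC hu i) hb
    (tendsto_semigroup hΛ hc)).congr' ?_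
  filter_upwards [eventually_ge_atTop 0] with T hT
  rw [integral_const_mul, hX.integral_integral_eq hC hΛ hu hT]

end IsMarkovChain

theorem integral_time_average_eq {P : Measure Ω} [IsProbabilityMeasure P] {v : ℝ × Ω → ℝ} {T : ℝ}
    (hT : 0 ≤ T) (hv : Integrable v ((volume.restrict (Set.Ioc 0 T)).prod P)) :
    ∫ ω, (1 / T) * (∫ t in (0 : ℝ)..T, v (t, ω)) ∂P =
      (1 / T) * ∫ p, v p ∂((volume.restrict (Set.Ioc 0 T)).prod P) := by
  rw [integral_const_mul, integral_prod_symm _ hv]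
  simp only [intervalIntegral.integral_of_le hT]

variable {P : Q.Policy → ℕ → Measure Ω} {X : ℝ → Ω → ℕ} {η : ℝ} {g : ℕ → ℝ}

theorem HasAverageCost.limit_mean_le (hη : Q.HasAverageCost P X d η)
    (hX : Q.IsMarkovChain d i (P d i) X) (hC : (Q.chain d).IsStochastic) (hΛ : 0 < Q.unifRate)
    (hu : (Q.chain d).HasBoundedMeans u) (hle : ∀ n, u n ≤ Q.costRate n (d n)) {c : ℝ}
    (hc : Tendsto ((Q.chain d).mean u i) atTop (𝓝 c)) : c ≤ η := by
  have := hX.isProbabilityMeasure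
  refine le_of_tendsto_of_tendsto (hX.tendsto_average hC hΛ hu hc) (hη i).2 ?_
  filter_upwards [eventually_ge_atTop 0] with T hT
  have hu' := hX.integrable_prod hC hΛ hu T
  have hcost := (hη i).1 T
  rw [integral_time_average_eq hT hu', integral_time_average_eq hT hcost]
  exact mul_le_mul_of_nonneg_left (integral_mono hu' hcost fun p => hle _) (by positivity)

theorem IsPotential.isRelativeValue (hg : Q.IsPotential P X d η g)
    (hX : ∀ n, Q.IsMarkovChain d n (P d n) X) (hC : (Q.chain d).IsStochastic)
    (hΛ : 0 < Q.unifRate) (hbdd : (Q.chain d).HasBoundedMeans fun n => Q.costRate n (d n) - η)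
    (hlim : ∀ i, Tendsto ((Q.chain d).mean (fun n => Q.costRate n (d n) - η) i) atTop (𝓝 0)) :
    Q.IsRelativeValue d η g := by
  intro n
  have hint : ∀ i, Tendsto (fun T : ℝ => ∫ t in (0 : ℝ)..T,
      Q.semigroup d (fun n => Q.costRate n (d n) - η) i t) atTop (𝓝 (g i)) := fun i =>
    (hg i).congr' <| (eventually_ge_atTop 0).mono fun T hT =>
      (hX i).integral_integral_eq hC hΛ hbdd hT
  have hgen : Tendsto (fun T => Q.generator d (fun i => ∫ t in (0 : ℝ)..T,
      Q.semigroup d (fun n => Q.costRate n (d n) - η) i t) n) atTop (𝓝 (Q.generator d g n)) :=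
    (((hint _).sub (hint _)).const_mul _).add (((hint _).sub (hint _)).const_mul _)
  simp only [generator_integral_semigroup hC hbdd hΛ.ne'] at hgen
  have := tendsto_nhds_unique hgen ((tendsto_semigroup hΛ (hlim n)).sub_const _)
  linarith

/-! ### Costs -/

variable (Q) in
/-- The operating cost rate of an action. -/
def operatingCost (m : Q.Action) : ℝ := ∑ k, (m k : ℝ) * Q.c k

theorem costRate_eq (n : ℕ) (m : Q.Action) : Q.costRate n m = Q.h n + Q.operatingCost m := rfl

theorem operatingCost_nonneg (hc : ∀ k, 0 ≤ Q.c k) (m : Q.Action) : 0 ≤ Q.operatingCost m :=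
  Finset.sum_nonneg fun k _ => mul_nonneg (Nat.cast_nonneg _) (hc k)

theorem operatingCost_le (hc : ∀ k, 0 ≤ Q.c k) {m : Q.Action} (hm : m ≤ Q.M) :
    Q.operatingCost m ≤ Q.operatingCost Q.M :=
  Finset.sum_le_sum fun k _ => mul_le_mul_of_nonneg_right (Nat.cast_le.2 (hm k)) (hc k)

theorem serviceRate_pos (hmu : ∀ k, 0 < Q.mu k) {m : Q.Action} (hm : m ≠ 0) :
    0 < Q.serviceRate m := by
  obtain ⟨k, hk⟩ := Function.ne_iff.1 hm
  exact Finset.sum_pos' (fun j _ => mul_nonneg (Nat.cast_nonneg _) (hmu j).le)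
    ⟨k, Finset.mem_univ k, mul_pos (Nat.cast_pos.2 (Nat.pos_of_ne_zero hk)) (hmu k)⟩

/-- The assumptions on the parameters of the queue: positive arrival and service rates, nonnegative
operating costs, and a nondecreasing convex holding cost that tends to infinity. -/
structure StandingAssumptions (Q : GroupServerQueue) : Prop where
  lam_pos : 0 < Q.lam
  mu_pos : ∀ k, 0 < Q.mu k
  c_nonneg : ∀ k, 0 ≤ Q.c k
  h_monotone : Monotone Q.h
  h_convex : ConvexSeq Q.h
  h_tendsto : Tendsto Q.h atTop atTop

theorem StandingAssumptions.unifRate_pos (hQ : Q.StandingAssumptions) : 0 < Q.unifRate :=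
  GroupServerQueue.unifRate_pos hQ.lam_pos fun k => (hQ.mu_pos k).le

theorem StandingAssumptions.chain_isStochastic (hQ : Q.StandingAssumptions)
    (hd : d ∈ Q.efficientPolicies) : (Q.chain d).IsStochastic :=
  GroupServerQueue.chain_isStochastic hQ.lam_pos (fun k => (hQ.mu_pos k).le) hd

theorem hasBoundedMeans_operatingCost (hc : ∀ k, 0 ≤ Q.c k) (hC : (Q.chain d).IsStochastic)
    (hd : d ∈ Q.efficientPolicies) :
    (Q.chain d).HasBoundedMeans fun n => Q.operatingCost (d n) :=
  .of_abs_le hC fun n => (abs_of_nonneg (operatingCost_nonneg hc (d n))).trans_le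
    (operatingCost_le hc (hd n).1)

theorem hasBoundedMeans_costRate (hc : ∀ k, 0 ≤ Q.c k) (hC : (Q.chain d).IsStochastic)
    (hd : d ∈ Q.efficientPolicies) (hh : (Q.chain d).HasBoundedMeans Q.h) :
    (Q.chain d).HasBoundedMeans fun n => Q.costRate n (d n) :=
  hh.add hC (hasBoundedMeans_operatingCost hc hC hd)

theorem StandingAssumptions.exists_tendsto_mean_costRate (hQ : Q.StandingAssumptions)
    (hd : d ∈ Q.efficientPolicies) (hh : (Q.chain d).HasBoundedMeans Q.h) :
    ∃ c, ∀ i, Tendsto ((Q.chain d).mean (fun n => Q.costRate n (d n)) i) atTop (𝓝 c) := by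
  have hC := hQ.chain_isStochastic hd
  refine hC.exists_tendsto_mean_of_sub_le (hh.natCast hC hQ.h_convex hQ.h_tendsto)
    (hasBoundedMeans_costRate hQ.c_nonneg hC hd hh) (B := Q.operatingCost Q.M) fun n => ?_
  rw [costRate_eq, costRate_eq]
  linarith [hQ.h_monotone (Nat.le_succ n), operatingCost_le hQ.c_nonneg (hd n).1,
    operatingCost_nonneg hQ.c_nonneg (d (n + 1))]

namespace HasAverageCost

-- Only bounded functions are known to be integrable so far, hence the truncation of `h`.
theorem mean_holding_le (hη : Q.HasAverageCost P X d η) (hX : Q.IsMarkovChain d 0 (P d 0) X)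
    (hC : (Q.chain d).IsStochastic) (hΛ : 0 < Q.unifRate) (hc : ∀ k, 0 ≤ Q.c k)
    (hmono : Monotone Q.h) (l : ℕ) : (Q.chain d).mean Q.h 0 l ≤ η := by
  refine le_of_tendsto' (BirthDeathChain.tendsto_mean_of_tendsto (f := atTop)
    (v := fun (N : ℕ) n => min (Q.h n) N) (fun n => ?_) 0 l) fun N => ?_
  · obtain ⟨N, hN⟩ := exists_nat_ge (Q.h n)
    refine tendsto_const_nhds.congr' ?_
    filter_upwards [eventually_ge_atTop N] with N' hN'
    exact (min_eq_left (hN.trans (Nat.cast_le.2 hN'))).symm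
  · have htrunc : Monotone fun n => min (Q.h n) (N : ℝ) := hmono.min monotone_const
    have hbdd : (Q.chain d).HasBoundedMeans fun n => min (Q.h n) (N : ℝ) :=
      .of_bddBelow hC
        (bddBelow_range_of_eventually_le_succ (.of_forall fun n => htrunc (Nat.le_succ n)))
        (hC.mean_le (fun n => min_le_right _ _) 0)
    obtain ⟨c, hlim⟩ := hC.exists_tendsto_mean_of_monotone htrunc hbdd
    refine ((hC.monotone_mean htrunc hC.down_zero).ge_of_tendsto (hlim 0) l).trans
      (hη.limit_mean_le hX hC hΛ hbdd (fun n => ?_) (hlim 0))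
    exact (min_le_left _ _).trans (le_add_of_nonneg_right (operatingCost_nonneg hc (d n)))

theorem of_tendsto (hX : ∀ n, Q.IsMarkovChain d n (P d n) X) (hC : (Q.chain d).IsStochastic)
    (hΛ : 0 < Q.unifRate) (hcost : (Q.chain d).HasBoundedMeans fun n => Q.costRate n (d n))
    (hη : ∀ i, Tendsto ((Q.chain d).mean (fun n => Q.costRate n (d n)) i) atTop (𝓝 η)) :
    Q.HasAverageCost P X d η :=
  fun n => ⟨(hX n).integrable_prod hC hΛ hcost, (hX n).tendsto_average hC hΛ hcost (hη n)⟩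

variable (hη : Q.HasAverageCost P X d η) (hQ : Q.StandingAssumptions)
  (hX : ∀ n, Q.IsMarkovChain d n (P d n) X) (hd : d ∈ Q.efficientPolicies)
include hη hQ hX hd

theorem hasBoundedMeans_holding : (Q.chain d).HasBoundedMeans Q.h :=
  have hC := hQ.chain_isStochastic hd
  .of_bddBelow hC
    (bddBelow_range_of_eventually_le_succ (.of_forall fun n => hQ.h_monotone (Nat.le_succ n)))
    (hη.mean_holding_le (hX 0) hC hQ.unifRate_pos hQ.c_nonneg hQ.h_monotone)

theorem tendsto_mean_costRate (i : ℕ) :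
    Tendsto ((Q.chain d).mean (fun n => Q.costRate n (d n)) i) atTop (𝓝 η) := by
  have hC := hQ.chain_isStochastic hd
  have hh := hη.hasBoundedMeans_holding hQ hX hd
  obtain ⟨c, hc⟩ := hQ.exists_tendsto_mean_costRate hd hh
  have haverage := (hX 0).tendsto_average hC hQ.unifRate_pos
    (hasBoundedMeans_costRate hQ.c_nonneg hC hd hh) (hc 0)
  exact tendsto_nhds_unique haverage (hη 0).2 ▸ hc i

theorem tendsto_mean_costRate_sub (i : ℕ) :
    Tendsto ((Q.chain d).mean (fun n => Q.costRate n (d n) - η) i) atTop (𝓝 0) := by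
  have hsub : (fun n => Q.costRate n (d n) - η) = (fun n => Q.costRate n (d n)) - fun _ => η := rfl
  have hlim := (hη.tendsto_mean_costRate hQ hX hd i).sub_const η
  rw [sub_self] at hlim
  refine hlim.congr fun l => ?_
  rw [hsub, BirthDeathChain.mean_sub, Pi.sub_apply, BirthDeathChain.mean_const]

theorem isRelativeValue_of_isPotential (hg : Q.IsPotential P X d η g) :
    Q.IsRelativeValue d η g := by
  have hC := hQ.chain_isStochastic hd
  refine hg.isRelativeValue hX hC hQ.unifRate_pos ?_ (hη.tendsto_mean_costRate_sub hQ hX hd)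
  exact (hasBoundedMeans_costRate hQ.c_nonneg hC hd (hη.hasBoundedMeans_holding hQ hX hd)).add hC
    (.of_abs_le hC fun _ => le_rfl)

theorem holding_le_of_eq_zero {j : ℕ} (hj : d j = 0) : Q.h j ≤ η := by
  have hC := hQ.chain_isStochastic hd
  refine ge_of_tendsto' (hη.tendsto_mean_costRate hQ hX hd j) fun l => ?_
  have hdown : (Q.chain d).down j = 0 := by simp [chain, hj]
  exact (hC.monotone_mean hQ.h_monotone hdown (Nat.zero_le l)).trans
    (hC.mean_mono (fun n => le_add_of_nonneg_right (operatingCost_nonneg hQ.c_nonneg (d n))) j l)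

end HasAverageCost

/-! ### Optimality -/

theorem step_smul_unifRate (hΛ : Q.unifRate ≠ 0) (d : Q.Policy) (g : ℕ → ℝ) :
    (Q.chain d).step (Q.unifRate • g) = Q.unifRate • g + Q.generator d g := by
  ext n
  simp only [BirthDeathChain.step_apply, chain, generator, Pi.add_apply, Pi.smul_apply, smul_eq_mul]
  field_simp
  ring

theorem StandingAssumptions.limitLaw_pos (hQ : Q.StandingAssumptions) (hd : d ∈ Q.efficientPolicies)
    (hh : (Q.chain d).HasBoundedMeans Q.h) {p : ℕ → ℝ} (hp : (Q.chain d).IsLimitLaw p) {m : ℕ}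
    (hm : ∀ j, m < j → d j ≠ 0) {k : ℕ} (hk : m ≤ k) : 0 < p k :=
  hp.pos (hQ.chain_isStochastic hd) hh hQ.h_tendsto
    (fun j hj => div_pos (serviceRate_pos hQ.mu_pos (hm j hj)) hQ.unifRate_pos) hk

theorem IsRelativeValue.eventually_le_succ (hg : Q.IsRelativeValue d η g)
    (hη : Q.HasAverageCost P X d η) (hQ : Q.StandingAssumptions)
    (hX : ∀ n, Q.IsMarkovChain d n (P d n) X) (hd : d ∈ Q.efficientPolicies)
    {m : ℕ} (hm : ∀ j, m < j → d j ≠ 0) : ∀ᶠ k in atTop, g k ≤ g (k + 1) := by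
  have hC := hQ.chain_isStochastic hd
  have hh := hη.hasBoundedMeans_holding hQ hX hd
  obtain ⟨p, hp⟩ := hC.exists_isLimitLaw
  have hpos : ∀ᶠ k in atTop, 0 < p k := (eventually_ge_atTop m).mono fun k hk =>
    hQ.limitLaw_pos hd hh hp hm hk
  have hstep : (Q.chain d).step (Q.unifRate • g) =
      Q.unifRate • g - fun n => Q.costRate n (d n) - η := by
    rw [step_smul_unifRate hQ.unifRate_pos.ne']
    ext n
    simp only [Pi.add_apply, Pi.sub_apply]
    linarith [hg n]
  have hcost : ∀ᶠ k in atTop, 0 ≤ Q.costRate k (d k) - η := by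
    filter_upwards [hQ.h_tendsto.eventually_ge_atTop η] with k hk
    rw [costRate_eq]
    linarith [operatingCost_nonneg hQ.c_nonneg (d k)]
  exact (hp.eventually_le_succ hC hpos hstep (hη.tendsto_mean_costRate_sub hQ hX hd 0) hcost).mono
    fun k hk => le_of_mul_le_mul_left hk hQ.unifRate_pos

-- A strict improvement in the recurrent state `m` lowers the average cost in proportion to the
-- limiting probability of `m`.
theorem StandingAssumptions.exists_hasAverageCost_lt (hQ : Q.StandingAssumptions)
    (hX : ∀ n, Q.IsMarkovChain d n (P d n) X) (hd : d ∈ Q.efficientPolicies)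
    (hg : BddBelow (Set.range g)) {m : ℕ} (hm : ∀ j, m < j → d j ≠ 0) {ε : ℝ} (hε : 0 < ε)
    (hdrift : ∀ n, Q.costRate n (d n) + Q.generator d g n ≤ η - ε * (Pi.single m 1 : ℕ → ℝ) n) :
    ∃ η' < η, Q.HasAverageCost P X d η' := by
  have hC := hQ.chain_isStochastic hd
  have hstep : (Q.chain d).step (Q.unifRate • g) ≤ Q.unifRate • g -
      ((fun n => Q.costRate n (d n)) - (fun _ => η) + ε • Pi.single m 1) := by
    rw [step_smul_unifRate hQ.unifRate_pos.ne']
    intro n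
    simp only [Pi.add_apply, Pi.sub_apply, Pi.smul_apply, smul_eq_mul]
    linarith [hdrift n]
  have hbdd : BddBelow (Set.range (Q.unifRate • g)) := by
    obtain ⟨b, hb⟩ := hg
    refine ⟨Q.unifRate * b, ?_⟩
    rintro _ ⟨n, rfl⟩
    exact mul_le_mul_of_nonneg_left (hb ⟨n, rfl⟩) hQ.unifRate_pos.le
  have hsingle : 0 ≤ (Pi.single m 1 : ℕ → ℝ) := Pi.single_nonneg.2 zero_le_one
  have hh : (Q.chain d).HasBoundedMeans Q.h :=
    hC.hasBoundedMeans_of_drift hQ.h_monotone hbdd (c := η) (hstep.trans fun n => by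
      simp only [Pi.add_apply, Pi.sub_apply, Pi.smul_apply, smul_eq_mul, costRate_eq]
      linarith [operatingCost_nonneg hQ.c_nonneg (d n), mul_nonneg hε.le (hsingle n)])
  obtain ⟨η', hη'⟩ := hQ.exists_tendsto_mean_costRate hd hh
  obtain ⟨p, hp⟩ := hC.exists_isLimitLaw
  have hlim := hC.nonpos_of_drift (i := 0) (c := η' - η + ε * p m) hbdd hstep (by
    simp only [BirthDeathChain.mean_add, BirthDeathChain.mean_sub, BirthDeathChain.mean_smul,
      funext (BirthDeathChain.mean_const η 0)]
    exact ((hη' 0).sub_const η).add ((hp m 0).const_mul ε))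
  exact ⟨η', by linarith [mul_pos hε (hQ.limitLaw_pos hd hh hp hm le_rfl)],
    .of_tendsto hX hC hQ.unifRate_pos (hasBoundedMeans_costRate hQ.c_nonneg hC hd hh) hη'⟩

theorem IsOptimal.le_of_drift (hopt : Q.IsOptimal P X d η) (hQ : Q.StandingAssumptions)
    {d' : Q.Policy} (hX : ∀ n, Q.IsMarkovChain d' n (P d' n) X) (hd' : d' ∈ Q.efficientPolicies)
    (hg : BddBelow (Set.range g)) {m : ℕ} (hm : ∀ j, m < j → d' j ≠ 0)
    (hdrift : ∀ n ≠ m, Q.costRate n (d' n) + Q.generator d' g n ≤ η) :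
    η ≤ Q.costRate m (d' m) + Q.generator d' g m := by
  by_contra! hlt
  obtain ⟨η', hlt', hη'⟩ := hQ.exists_hasAverageCost_lt hX hd' hg hm (sub_pos.2 hlt) fun n => by
    rcases eq_or_ne n m with rfl | hn
    · rw [Pi.single_eq_same]
      linarith
    · rw [Pi.single_eq_of_ne hn]
      linarith [hdrift n hn]
  exact hlt'.not_ge (hopt.le d' hd' η' hη')

variable (Q) in
/-- The rate of net gain from action `m` if a service completion is worth `x`. -/
def gain (x : ℝ) (m : Q.Action) : ℝ := Q.serviceRate m * x - Q.operatingCost m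

theorem gain_eq_sum (x : ℝ) (m : Q.Action) :
    Q.gain x m = ∑ k, (m k : ℝ) * (Q.mu k * x - Q.c k) := by
  simp only [gain, serviceRate, operatingCost, Finset.sum_mul, mul_sub, Finset.sum_sub_distrib,
    mul_assoc]

theorem gain_mono (hmu : ∀ k, 0 ≤ Q.mu k) (m : Q.Action) : Monotone fun x => Q.gain x m :=
  fun _ _ hxy => sub_le_sub_right (mul_le_mul_of_nonneg_left hxy (serviceRate_nonneg hmu m)) _

@[simp]
theorem gain_zero (x : ℝ) : Q.gain x 0 = 0 := by simp [gain_eq_sum]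

theorem gain_add_single (x : ℝ) (m : Q.Action) (k : Fin Q.K) :
    Q.gain x (m + Pi.single k 1) = Q.gain x m + (Q.mu k * x - Q.c k) := by
  simp [gain_eq_sum, Pi.single_apply, add_mul, Finset.sum_add_distrib]

theorem costRate_add_generator (n : ℕ) (d : Q.Policy) (g : ℕ → ℝ) :
    Q.costRate n (d n) + Q.generator d g n =
      Q.h n + Q.lam * backwardDiff g (n + 1) - Q.gain (backwardDiff g n) (d n) := by
  rw [costRate_eq, generator, gain, backwardDiff_succ, backwardDiff]
  ring

theorem IsRelativeValue.lam_mul_backwardDiff_succ (hg : Q.IsRelativeValue d η g) (n : ℕ) :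
    Q.lam * backwardDiff g (n + 1) = η - Q.h n + Q.gain (backwardDiff g n) (d n) := by
  linarith [hg n, costRate_add_generator n d g]

/-! ### An optimal policy is never idle in a nonempty system -/

theorem HasAverageCost.exists_last_idle (hη : Q.HasAverageCost P X d η)
    (hQ : Q.StandingAssumptions) (hX : ∀ n, Q.IsMarkovChain d n (P d n) X)
    (hd : d ∈ Q.efficientPolicies) {j : ℕ} (hj : d j = 0) :
    ∃ m ≥ j, d m = 0 ∧ ∀ i, m < i → d i ≠ 0 := by
  obtain ⟨N, hN⟩ := eventually_atTop.1 (hQ.h_tendsto.eventually_gt_atTop η)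
  have hfinite : {i | d i = 0}.Finite := (Set.finite_lt_nat N).subset fun i hi =>
    lt_of_not_ge fun hNi => (hN i hNi).not_ge (hη.holding_le_of_eq_zero hQ hX hd hi)
  obtain ⟨m, hm, hmax⟩ := Set.exists_max_image _ id hfinite ⟨j, hj⟩
  exact ⟨m, hmax j hj, hm, fun i hi hidle => hi.not_ge (hmax i hidle)⟩

theorem IsRelativeValue.lam_mul_backwardDiff_succ_le (hg : Q.IsRelativeValue d η g)
    (hQ : Q.StandingAssumptions) {m : ℕ} (hidle : d m = 0)
    (hgain : ∀ n, Q.gain (backwardDiff g (m + 1)) (d n) ≤ 0) {n : ℕ} (hn : m ≤ n) :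
    Q.lam * backwardDiff g (n + 1) ≤ η - Q.h n := by
  have hslope : Q.lam * backwardDiff g (m + 1) = η - Q.h m := by
    rw [hg.lam_mul_backwardDiff_succ, hidle, gain_zero, add_zero]
  induction n, hn using Nat.le_induction with
  | base => exact hslope.le
  | succ n hn ih =>
    have hdiff : backwardDiff g (n + 1) ≤ backwardDiff g (m + 1) :=
      le_of_mul_le_mul_left (by linarith [hQ.h_monotone hn]) hQ.lam_pos
    have hgain_le := gain_mono (fun k => (hQ.mu_pos k).le) (d (n + 1)) hdiff
    rw [hg.lam_mul_backwardDiff_succ]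
    linarith [hgain (n + 1)]

namespace IsOptimal

variable (hopt : Q.IsOptimal P X d η) (hQ : Q.StandingAssumptions)
  (hX : ∀ d ∈ Q.efficientPolicies, ∀ n, Q.IsMarkovChain d n (P d n) X)
  (hg : Q.IsRelativeValue d η g)
include hopt hQ hX hg

theorem eventually_le_succ {m : ℕ} (hm : ∀ j, m < j → d j ≠ 0) : ∀ᶠ n in atTop, g n ≤ g (n + 1) :=
  hg.eventually_le_succ hopt.hasAverageCost hQ (hX d hopt.efficient) hopt.efficient hm

-- `d` is compared with the policy that uses `a` in `m` and idles below `m`.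
theorem gain_nonpos_of_idle {m : ℕ} (hm : 0 < m) (hidle : d m = 0) (hlast : ∀ j, m < j → d j ≠ 0)
    {a : Q.Action} (ha : a ∈ Q.efficientActions m) : Q.gain (backwardDiff g (m + 1)) a ≤ 0 := by
  set d' : Q.Policy := fun n => if m < n then d n else if n = m then a else 0
  have hd' : d' ∈ Q.efficientPolicies := fun n => by
    simp only [d']
    split_ifs with hlt heq
    · exact hopt.efficient n
    · exact heq ▸ ha
    · exact zero_mem_efficientActions n
  have hd'_gt : ∀ j, m < j → d' j = d j := fun j hj => if_pos hj
  have hd'_self : d' m = a := by simp [d']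
  have hslope : Q.h m + Q.lam * backwardDiff g (m + 1) = η := by
    rw [hg.lam_mul_backwardDiff_succ, hidle, gain_zero]
    ring
  have hle := hopt.le_of_drift hQ (hX d' hd') hd'
    (bddBelow_range_extendBelow (hopt.eventually_le_succ hQ hX hg hlast) m)
    (fun j hj => hd'_gt j hj ▸ hlast j hj) fun n hn => by
      rcases hn.lt_or_gt with hlt | hgt
      · have hzero : d' n = 0 := by simp [d', hlt.not_gt, hn]
        rw [costRate_add_generator, hzero, gain_zero, backwardDiff_extendBelow_succ_of_le hlt.le]
        linarith [hQ.h_monotone hlt.le]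
      · rw [costRate_add_generator, hd'_gt n hgt, backwardDiff_extendBelow_of_lt hgt,
          backwardDiff_extendBelow_of_lt (hgt.trans n.lt_succ_self), hg.lam_mul_backwardDiff_succ]
        linarith
  have hself : backwardDiff (extendBelow g m) m = backwardDiff g (m + 1) := by
    simpa only [Nat.sub_add_cancel hm] using
      backwardDiff_extendBelow_succ_of_le (g := g) (Nat.sub_le m 1)
  rw [costRate_add_generator, hd'_self, backwardDiff_extendBelow_succ_of_le le_rfl, hself] at hle
  linarith

theorem ne_zero {j : ℕ} (hj : 0 < j) : d j ≠ 0 := by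
  intro hidle
  obtain ⟨m, hjm, hm, hlast⟩ := hopt.hasAverageCost.exists_last_idle hQ (hX d hopt.efficient)
    hopt.efficient hidle
  have hserver : ∀ k, 0 < Q.M k → Q.mu k * backwardDiff g (m + 1) ≤ Q.c k := fun k hk => by
    have hmem : Pi.single k 1 ∈ Q.efficientActions m :=
      ⟨single_one_le hk, by simpa using Nat.succ_le_of_lt (hj.trans_le hjm)⟩
    have hgain := hopt.gain_nonpos_of_idle hQ hX hg (hj.trans_le hjm) hm hlast hmem
    rw [← zero_add (Pi.single k 1), gain_add_single, gain_zero] at hgain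
    linarith
  have hgain : ∀ n, Q.gain (backwardDiff g (m + 1)) (d n) ≤ 0 := fun n => by
    rw [gain_eq_sum]
    refine Finset.sum_nonpos fun k _ => ?_
    rcases (d n k).eq_zero_or_pos with hk | hk
    · simp [hk]
    · exact mul_nonpos_of_nonneg_of_nonpos (Nat.cast_nonneg _)
        (sub_nonpos.2 (hserver k (hk.trans_le ((hopt.efficient n).1 k))))
  obtain ⟨n, hincr, hn, hmn⟩ := ((hopt.eventually_le_succ hQ hX hg hlast).and
    ((hQ.h_tendsto.eventually_gt_atTop η).and (eventually_ge_atTop m))).exists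
  have hle := hg.lam_mul_backwardDiff_succ_le hQ hm hgain hmn
  have hnonneg := mul_nonneg hQ.lam_pos.le (sub_nonneg.2 hincr)
  rw [backwardDiff_succ] at hle
  linarith

-- `d` is compared with the policy that differs from `d` only in state `n`, where it uses `a`.
theorem gain_le {n : ℕ} {a : Q.Action} (ha : a ∈ Q.efficientActions n) :
    Q.gain (backwardDiff g n) a ≤ Q.gain (backwardDiff g n) (d n) := by
  have hupdate : ∀ i ≠ n, Function.update d n a i = d i := fun i hi => Function.update_of_ne hi ..
  have hd' : Function.update d n a ∈ Q.efficientPolicies := fun i => by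
    rcases eq_or_ne i n with rfl | hi
    · rwa [Function.update_self]
    · exact hupdate i hi ▸ hopt.efficient i
  have hbdd := bddBelow_range_of_eventually_le_succ
    (hopt.eventually_le_succ hQ hX hg (m := 0) fun j => hopt.ne_zero hQ hX hg)
  have hle := hopt.le_of_drift hQ (hX _ hd') hd' hbdd
    (fun j hj => hupdate j hj.ne' ▸ hopt.ne_zero hQ hX hg (Nat.zero_lt_of_lt hj)) fun i hi => by
      rw [costRate_add_generator, hupdate i hi, hg.lam_mul_backwardDiff_succ]
      linarith
  rw [costRate_add_generator, Function.update_self, hg.lam_mul_backwardDiff_succ] at hle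
  linarith

end IsOptimal

/-! ### The maximal gain -/

variable (Q) in
/-- The maximal rate of net gain in state `n` if a service completion is worth `x`. -/
def maxGain (n : ℕ) (x : ℝ) : ℝ := sSup (Q.gain x '' Q.efficientActions n)

theorem finite_efficientActions (n : ℕ) : (Q.efficientActions n).Finite :=
  (Set.finite_Iic Q.M).subset fun _ hm => hm.1

theorem gain_le_maxGain {n : ℕ} {m : Q.Action} (hm : m ∈ Q.efficientActions n) (x : ℝ) :
    Q.gain x m ≤ Q.maxGain n x :=
  le_csSup ((finite_efficientActions n).image _).bddAbove (Set.mem_image_of_mem _ hm)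

theorem exists_gain_eq_maxGain (n : ℕ) (x : ℝ) :
    ∃ m ∈ Q.efficientActions n, Q.gain x m = Q.maxGain n x :=
  (Set.Nonempty.image _ ⟨0, zero_mem_efficientActions n⟩).csSup_mem
    ((finite_efficientActions n).image _)

theorem efficientActions_mono : Monotone Q.efficientActions :=
  fun _ _ h _ hm => ⟨hm.1, hm.2.trans h⟩

theorem maxGain_le_succ (n : ℕ) (x : ℝ) : Q.maxGain n x ≤ Q.maxGain (n + 1) x := by
  obtain ⟨m, hm, hmax⟩ := exists_gain_eq_maxGain n x
  exact hmax ▸ gain_le_maxGain (efficientActions_mono n.le_succ hm) x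

theorem maxGain_mono (hmu : ∀ k, 0 ≤ Q.mu k) (n : ℕ) : Monotone (Q.maxGain n) := fun x y hxy => by
  obtain ⟨m, hm, hmax⟩ := exists_gain_eq_maxGain n x
  exact hmax ▸ (gain_mono hmu m hxy).trans (gain_le_maxGain hm y)

theorem exists_exchange {n n' : ℕ} (hn : n ≤ n') {m p : Q.Action}
    (hm : m ∈ Q.efficientActions (n' + 1)) (hm' : m ∉ Q.efficientActions n')
    (hp : p ∈ Q.efficientActions n) :
    ∃ k, ∃ q ∈ Q.efficientActions n', m = q + Pi.single k 1 ∧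
      p + Pi.single k 1 ∈ Q.efficientActions (n + 1) := by
  have hsum : n' < ∑ k, m k := not_le.1 fun h => hm' ⟨hm.1, h⟩
  obtain ⟨k, -, hk⟩ := Finset.exists_lt_of_sum_lt (hp.2.trans_lt (hn.trans_lt hsum))
  obtain ⟨q, rfl⟩ : ∃ q, m = q + Pi.single k 1 :=
    ⟨m - Pi.single k 1, (tsub_add_cancel_of_le (single_one_le (Nat.zero_lt_of_lt hk))).symm⟩
  have hqsum := hm.2
  simp only [Pi.add_apply, Finset.sum_add_distrib, Finset.sum_pi_single', Finset.mem_univ,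
    if_true, Nat.add_le_add_iff_right] at hqsum
  refine ⟨k, q, ⟨fun j => (Nat.le_add_right _ _).trans (hm.1 j), hqsum⟩, rfl, fun j => ?_, ?_⟩
  · rcases eq_or_ne j k with rfl | hj
    · simpa using (Nat.succ_le_of_lt hk).trans (hm.1 j)
    · simpa [hj] using hp.1 j
  · simpa [Finset.sum_add_distrib] using hp.2

-- The server switched on last in the larger state is still available in the smaller one.
theorem maxGain_succ_sub_le (hmu : ∀ k, 0 ≤ Q.mu k) {n n' : ℕ} (hn : n ≤ n') {x y : ℝ}
    (hxy : x ≤ y) :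
    Q.maxGain (n' + 1) x - Q.maxGain n' x ≤ Q.maxGain (n + 1) y - Q.maxGain n y := by
  obtain ⟨m, hm, hm_max⟩ := exists_gain_eq_maxGain (n' + 1) x
  obtain ⟨p, hp, hp_max⟩ := exists_gain_eq_maxGain (Q := Q) n y
  by_cases hm' : m ∈ Q.efficientActions n'
  · linarith [gain_le_maxGain hm' x, maxGain_le_succ (Q := Q) n y]
  · obtain ⟨k, q, hq, rfl, hpk⟩ := exists_exchange hn hm hm' hp
    have hq_le := gain_le_maxGain hq x
    have hpk_le := gain_le_maxGain hpk y
    rw [gain_add_single] at hm_max hpk_le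
    linarith [mul_le_mul_of_nonneg_left hxy (hmu k)]

theorem IsOptimal.monotone_backwardDiff (hopt : Q.IsOptimal P X d η) (hQ : Q.StandingAssumptions)
    (hX : ∀ d ∈ Q.efficientPolicies, ∀ n, Q.IsMarkovChain d n (P d n) X)
    (hg : Q.IsRelativeValue d η g) : Monotone (backwardDiff g) := by
  have hmu := fun k => (hQ.mu_pos k).le
  have hoptimality : ∀ n, Q.lam * backwardDiff g (n + 1) =
      η - Q.h n + Q.maxGain n (backwardDiff g n) := fun n => by
    obtain ⟨m, hm, hmax⟩ := exists_gain_eq_maxGain n (backwardDiff g n)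
    rw [hg.lam_mul_backwardDiff_succ, ← hmax]
    exact congrArg _ ((hmax ▸ gain_le_maxGain (hopt.efficient n) _).antisymm
      (hopt.gain_le hQ hX hg hm))
  have hidle : d 0 = 0 := eq_zero_of_mem_efficientActions_zero (hopt.efficient 0)
  have hzero_le : backwardDiff g 0 ≤ backwardDiff g 1 := by
    have hh := hopt.hasAverageCost.holding_le_of_eq_zero hQ (hX d hopt.efficient) hopt.efficient
      hidle
    have hslope := hg.lam_mul_backwardDiff_succ 0
    rw [hidle, gain_zero] at hslope
    rw [backwardDiff_zero]
    exact nonneg_of_mul_nonneg_right (by linarith) hQ.lam_pos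
  refine monotone_of_recursion hQ.lam_pos hQ.h_convex (maxGain_mono hmu)
    (fun hn hxy => maxGain_succ_sub_le hmu hn hxy) hoptimality hzero_le ?_
  have hincr := hopt.eventually_le_succ hQ hX hg (m := 0) fun j => hopt.ne_zero hQ hX hg
  rw [← map_add_atTop_eq_nat 1]
  exact hincr.mono fun n hn => sub_nonneg.2 hn

end GroupServerQueue

end

theorem theorem4 (Q : GroupServerQueue)
    (hlam : 0 < Q.lam) (hmu : ∀ k, 0 < Q.mu k) (hc : ∀ k, 0 ≤ Q.c k)
    (h_mono : Monotone Q.h) (h_convex : ConvexSeq Q.h) (h_tendsto : Tendsto Q.h atTop atTop)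
    {Ω : Type*} [MeasurableSpace Ω] (P : Q.Policy → ℕ → Measure Ω) (X : ℝ → Ω → ℕ)
    (hX : ∀ d ∈ Q.efficientPolicies, ∀ n, Q.IsMarkovChain d n (P d n) X)
    (dstar : Q.Policy) (ηstar : ℝ) (hopt : Q.IsOptimal P X dstar ηstar)
    (gstar : ℕ → ℝ)
    (hg : Q.IsPotential P X dstar ηstar gstar ∨ Q.IsRelativeValue dstar ηstar gstar) :
    Monotone gstar ∧ ConvexSeq gstar := by
  have hQ : Q.StandingAssumptions := ⟨hlam, hmu, hc, h_mono, h_convex, h_tendsto⟩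
  have hrel : Q.IsRelativeValue dstar ηstar gstar := hg.elim
    (hopt.hasAverageCost.isRelativeValue_of_isPotential hQ (hX _ hopt.efficient) hopt.efficient) id
  have hdiff : Monotone (backwardDiff gstar) := hopt.monotone_backwardDiff hQ hX hrel
  exact ⟨monotone_of_monotone_backwardDiff hdiff, convexSeq_of_monotone_backwardDiff hdiff⟩
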